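/- Theorem 1.1. Let $X$ be a smooth projective (integral) curve over an algebraically closed field $\mathbb{K}$ of characteristic $\neq 2$, and let $E$ be an orthogonal bundle of rank $r$ on $X$, that is, a vector bundle of rank $r$ with a symmetric bilinear form $b : E \times E \to \mathcal{O}_X$ that is non-degenerate, i.e. induces an isomorphism $E \cong E^*$. Let $x \in X$ be a closed point with local ring $\mathcal{O} = \mathcal{O}_{X,x}$ and maximal ideal $\mathfrak{M}$, let $\mathbb{K}[\epsilon] = \mathcal{O}/\mathfrak{M}^2$ be the ring of dual numbers, let $\widehat{E}_x$ be the stalk of $E$ at $x$, and let $E_{2x} = \widehat{E}_x \otimes_{\mathcal{O}} \mathcal{O}/\mathfrak{M}^2$, with the $\mathbb{K}[\epsilon]$-valued bilinear form $b_2$ induced by $b$. Let $L \subset E_{2x}$ be a Lagrangian submodule, i.e. a $\mathbb{K}[\epsilon]$-submodule with $b_2(v,v) = 0$ for all $v \in L$ and $\dim_{\mathbb{K}} L = r$. Let $$E' = \ker\left(E \twoheadrightarrow E_{2x}/L\right),$$ where $E_{2x}/L$ is regarded as a skyscraper sheaf at $x$. Then the Hecke transform $\mathcal{H}(E,L) :=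 E' \otimes \mathcal{O}(x)$ is again an orthogonal bundle of rank $r$, for the form induced by $b$. That is, $\mathcal{H}(E,L)$ is a vector bundle of rank $r$, and there is a non-degenerate symmetric bilinear form $b' : \mathcal{H}(E,L) \times \mathcal{H}(E,L) \to \mathcal{O}_X$ such that $b'(s \otimes \varphi, t \otimes \psi) = \varphi\,\psi\, b(s,t)$ (as rational functions) for all local sections $s, t$ of $E'$ and $\varphi, \psi$ of $\mathcal{O}(x)$. -/

import Mathlib

open CategoryTheory AlgebraicGeometry Opposite TopologicalSpace
open scoped TensorProduct

universe u

namespace OrthogonalHecke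

noncomputable section

/-- Presheaves of `𝒪_X`-modules. -/
abbrev PreMod (X : Scheme.{u}) : Type (u + 1) :=
  PresheafOfModules.{u} (X.presheaf ⋙ forget₂ CommRingCat.{u} RingCat.{u})

/-- The underlying presheaf of a sheaf of `𝒪_X`-modules. -/
abbrev toPre {X : Scheme.{u}} (E : X.Modules) : PreMod X := E.val

/-- Restriction of functions from `U` to a smaller open set `V`. -/
abbrev resFun {X : Scheme.{u}} {U V : X.Opens} (h : V ≤ U) : Γ(X, U) →+* Γ(X, V) :=
  (X.presheaf.map (homOfLE h).op).hom

/-- Restriction of sections of a presheaf of modules, as a semilinear map. -/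
def res {X : Scheme.{u}} (M : PreMod X) {U V : X.Opens} (h : V ≤ U) :
    M.obj (op U) →ₛₗ[resFun h] M.obj (op V) where
  toFun s := M.map (homOfLE h).op s
  map_add' s t := map_add (M.map (homOfLE h).op).hom s t
  map_smul' a s := M.map_smul (homOfLE h).op a s

lemma resFun_resFun {X : Scheme.{u}} {U V W : X.Opens} (h : V ≤ U) (h' : W ≤ V) (a : Γ(X, U)) :
    resFun h' (resFun h a) = resFun (h'.trans h) a := by
  simp only [resFun, ← CommRingCat.comp_apply, ← Functor.map_comp]
  rfl

lemma res_res {X : Scheme.{u}} (M : PreMod X) {U V W : X.Opens} (h : V ≤ U) (h' : W ≤ V)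
    (s : M.obj (op U)) : res M h' (res M h s) = res M (h'.trans h) s :=
  (M.map_comp_apply (homOfLE h).op (homOfLE h').op s).symm

/-- `E` is a vector bundle of rank `r`: every point has an open neighbourhood `U` with sections
`e₁, …, e_r ∈ E(U)` that induce an isomorphism `𝒪_U^r ≅ E|_U`. -/
def IsVectorBundle {X : Scheme.{u}} (E : X.Modules) (r : ℕ) : Prop :=
  ∀ y : X, ∃ U : X.Opens, y ∈ U ∧ ∃ e : Fin r → (toPre E).obj (op U),
    ∀ (V : X.Opens) (hV : V ≤ U), Function.Bijective
      (fun c : Fin r → Γ(X, V) => ∑ i, c i • (res (toPre E) hV (e i) : (toPre E).obj (op V)))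

/-- The sections over `U` of the dual `M^* = ℋom(M, 𝒪_X)`: the morphisms `M|_U → 𝒪_U`, that is,
the families of linear maps `φ_V : M(V) → 𝒪(V)`, `V ⊆ U`, that commute with restriction. -/
def dualSections {X : Scheme.{u}} (M : PreMod X) (U : X.Opens) :
    AddSubgroup (∀ V : {V : X.Opens // V ≤ U}, M.obj (op V.1) →ₗ[Γ(X, V.1)] Γ(X, V.1)) where
  carrier := {φ | ∀ (V W : {V : X.Opens // V ≤ U}) (h : W.1 ≤ V.1) (s : M.obj (op V.1)),
    φ W (res M h s) = resFun h (φ V s)}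
  zero_mem' V W h s := by simp
  add_mem' {φ ψ} hφ hψ V W h s := by
    simp only [Pi.add_apply, LinearMap.add_apply, map_add, hφ V W h s, hψ V W h s]
  neg_mem' {φ} hφ V W h s := by
    simp only [Pi.neg_apply, LinearMap.neg_apply, map_neg, hφ V W h s]

instance {X : Scheme.{u}} (M : PreMod X) (U : X.Opens) : Module Γ(X, U) (dualSections M U) where
  smul a φ := ⟨fun V => resFun V.2 a • φ.1 V, fun V W h s => by
    simp only [LinearMap.smul_apply, smul_eq_mul, φ.2 V W h s, map_mul, resFun_resFun]⟩
  one_smul φ := by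
    refine Subtype.ext (funext fun V => ?_)
    change resFun V.2 1 • φ.1 V = φ.1 V
    rw [map_one, one_smul]
  mul_smul a b φ := by
    refine Subtype.ext (funext fun V => ?_)
    change resFun V.2 (a * b) • φ.1 V = resFun V.2 a • resFun V.2 b • φ.1 V
    rw [map_mul, mul_smul]
  smul_zero a := by
    refine Subtype.ext (funext fun V => ?_)
    change resFun V.2 a • (0 : M.obj (op V.1) →ₗ[Γ(X, V.1)] Γ(X, V.1)) = 0
    rw [smul_zero]
  smul_add a φ ψ := by
    refine Subtype.ext (funext fun V => ?_)
    change resFun V.2 a • (φ.1 V + ψ.1 V) = resFun V.2 a • φ.1 V + resFun V.2 a • ψ.1 V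
    rw [smul_add]
  add_smul a b φ := by
    refine Subtype.ext (funext fun V => ?_)
    change resFun V.2 (a + b) • φ.1 V = resFun V.2 a • φ.1 V + resFun V.2 b • φ.1 V
    rw [map_add, add_smul]
  zero_smul φ := by
    refine Subtype.ext (funext fun V => ?_)
    change resFun V.2 0 • φ.1 V = 0
    rw [map_zero, zero_smul]

/-- Restriction of a section of the dual from `U` to a smaller open set. -/
def dualRes {X : Scheme.{u}} (M : PreMod X) {U U' : X.Opens} (h : U' ≤ U) :
    dualSections M U →+ dualSections M U' where
  toFun φ := ⟨fun V => φ.1 ⟨V.1, V.2.trans h⟩, fun V W hWV s =>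
    φ.2 ⟨V.1, V.2.trans h⟩ ⟨W.1, W.2.trans h⟩ hWV s⟩
  map_zero' := rfl
  map_add' _ _ := rfl

/-- The underlying presheaf of abelian groups of the dual. -/
def dualPresheaf {X : Scheme.{u}} (M : PreMod X) : X.Opensᵒᵖ ⥤ Ab.{u} where
  obj U := AddCommGrpCat.of (dualSections M U.unop)
  map f := AddCommGrpCat.ofHom (dualRes M f.unop.le)
  map_id _ := rfl
  map_comp _ _ := rfl

instance {X : Scheme.{u}} (M : PreMod X) (U : X.Opensᵒᵖ) :
    Module ((X.presheaf ⋙ forget₂ CommRingCat.{u} RingCat.{u}).obj U) ((dualPresheaf M).obj U) :=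
  inferInstanceAs (Module Γ(X, U.unop) (dualSections M U.unop))

/-- The dual `M^* = ℋom(M, 𝒪_X)`. -/
def dual {X : Scheme.{u}} (M : PreMod X) : PreMod X :=
  PresheafOfModules.ofPresheaf (dualPresheaf M) (fun {U V} f a φ => by
    refine Subtype.ext (funext fun W => ?_)
    change resFun (W.2.trans f.unop.le) a • φ.1 ⟨W.1, W.2.trans f.unop.le⟩ =
      resFun W.2 (X.presheaf.map f a) • φ.1 ⟨W.1, W.2.trans f.unop.le⟩
    rw [← resFun_resFun f.unop.le W.2]
    rfl)

/-- The value at `s ∈ M(V)` of a section over `U` of the dual, where `V ⊆ U`. -/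
def dualEval {X : Scheme.{u}} {M : PreMod X} {U V : X.Opens} (φ : (dual M).obj (op U)) (hV : V ≤ U)
    (s : M.obj (op V)) : Γ(X, V) :=
  (show dualSections M U from φ).1 ⟨V, hV⟩ s

/-- A symmetric `𝒪_X`-bilinear form `M × M → 𝒪_X`. -/
structure SymmForm {X : Scheme.{u}} (M : PreMod X) where
  form (U : X.Opens) : LinearMap.BilinForm Γ(X, U) (M.obj (op U))
  symm (U : X.Opens) (s t : M.obj (op U)) : form U s t = form U t s
  form_res {U V : X.Opens} (h : V ≤ U) (s t : M.obj (op U)) :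
    form V (res M h s) (res M h t) = resFun h (form U s t)

/-- The map `M → M^*` induced by a bilinear form, on sections over `U`. -/
def SymmForm.toDual {X : Scheme.{u}} {M : PreMod X} (b : SymmForm M) (U : X.Opens)
    (s : M.obj (op U)) : (dual M).obj (op U) :=
  (⟨fun V => b.form V.1 (res M V.2 s), fun V W h t => by
    rw [← b.form_res h, res_res]⟩ : dualSections M U)

/-- A form is non-degenerate if it induces an isomorphism `M → M^*`. -/
def SymmForm.IsNondegenerate {X : Scheme.{u}} {M : PreMod X} (b : SymmForm M) : Prop :=
  ∀ U : X.Opens, Function.Bijective (b.toDual U)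

/-- The stalk of `M` at `x`, a module over the local ring `𝒪_{X,x}`. -/
abbrev stalk {X : Scheme.{u}} (M : PreMod X) (x : X) : Type u :=
  ↑(TopCat.Presheaf.stalk (C := Ab.{u}) (X := X.carrier) M.presheaf x)

/-- The germ at `x` of a section of `M`. -/
def germ {X : Scheme.{u}} (M : PreMod X) (x : X) {U : X.Opens} (hx : x ∈ U) (s : M.obj (op U)) :
    stalk M x :=
  TopCat.Presheaf.germ (C := Ab.{u}) (X := X.carrier) M.presheaf U x hx s

/-- The germ at `x` of a function. -/
abbrev germFun {X : Scheme.{u}} (x : X) {U : X.Opens} (hx : x ∈ U) :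
    Γ(X, U) →+* X.presheaf.stalk x :=
  (X.presheaf.germ U x hx).hom

section germs
variable {X : Scheme.{u}} (M : PreMod X) (x : X)

lemma germ_smul {U : X.Opens} (hx : x ∈ U) (a : Γ(X, U)) (s : M.obj (op U)) :
    germ M x hx (a • s) = germFun x hx a • germ M x hx s :=
  PresheafOfModules.germ_smul (R := X.presheaf) M x U hx a s

lemma germ_add {U : X.Opens} (hx : x ∈ U) (s t : M.obj (op U)) :
    germ M x hx (s + t) = germ M x hx s + germ M x hx t :=
  map_add (TopCat.Presheaf.germ (C := Ab.{u}) (X := X.carrier) M.presheaf U x hx).hom s t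

lemma germ_zero {U : X.Opens} (hx : x ∈ U) :
    germ M x hx (0 : M.obj (op U)) = 0 :=
  map_zero (TopCat.Presheaf.germ (C := Ab.{u}) (X := X.carrier) M.presheaf U x hx).hom

lemma germ_res {U V : X.Opens} (h : V ≤ U) (hx : x ∈ V) (s : M.obj (op U)) :
    germ M x hx (res M h s) = germ M x (h hx) s :=
  TopCat.Presheaf.germ_res_apply (C := Ab.{u}) (X := X.carrier) M.presheaf (homOfLE h) x hx s

lemma germFun_resFun {U V : X.Opens} (h : V ≤ U) (hx : x ∈ V) (a : Γ(X, U)) :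
    germFun x hx (resFun h a) = germFun x (h hx) a :=
  TopCat.Presheaf.germ_res_apply X.presheaf (homOfLE h) x hx a

lemma exists_germ (a : stalk M x) :
    ∃ (U : X.Opens) (hx : x ∈ U) (s : M.obj (op U)), germ M x hx s = a :=
  TopCat.Presheaf.exists_germ_eq (C := Ab.{u}) (X := X.carrier) M.presheaf a

lemma germ_eq {U V : X.Opens} (hU : x ∈ U) (hV : x ∈ V) (s : M.obj (op U)) (t : M.obj (op V))
    (h : germ M x hU s = germ M x hV t) :
    ∃ (W : X.Opens) (_ : x ∈ W) (h₁ : W ≤ U) (h₂ : W ≤ V), res M h₁ s = res M h₂ t := by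
  obtain ⟨W, hW, i, j, e⟩ := TopCat.Presheaf.germ_eq (C := Ab.{u}) (X := X.carrier)
    M.presheaf x hU hV s t h
  exact ⟨W, hW, i.le, j.le, e⟩

/-- The elements of two stalks are germs of sections over a common neighbourhood. -/
lemma exists_germ₂ (a a' : stalk M x) :
    ∃ (U : X.Opens) (hx : x ∈ U) (s s' : M.obj (op U)), germ M x hx s = a ∧ germ M x hx s' = a' := by
  obtain ⟨U, hU, s, rfl⟩ := exists_germ M x a
  obtain ⟨V, hV, t, rfl⟩ := exists_germ M x a'
  exact ⟨U ⊓ V, ⟨hU, hV⟩, res M inf_le_left s, res M inf_le_right t,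
    germ_res M x _ _ _, germ_res M x _ _ _⟩

end germs

section stalkForm
variable {X : Scheme.{u}} {M : PreMod X} (b : SymmForm M) (x : X)

lemma SymmForm.germ_form_congr {U V : X.Opens} (hU : x ∈ U) (hV : x ∈ V)
    (s s' : M.obj (op U)) (t t' : M.obj (op V))
    (h : germ M x hU s = germ M x hV t) (h' : germ M x hU s' = germ M x hV t') :
    germFun x hU (b.form U s s') = germFun x hV (b.form V t t') := by
  obtain ⟨W, hW, i, j, e⟩ := germ_eq M x hU hV s t h
  obtain ⟨W', hW', i', j', e'⟩ := germ_eq M x hU hV s' t' h'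
  have hx : x ∈ W ⊓ W' := ⟨hW, hW'⟩
  have e₁ : res M (inf_le_left.trans i : W ⊓ W' ≤ U) s = res M (inf_le_left.trans j) t := by
    rw [← res_res M i inf_le_left, e, res_res]
  have e₂ : res M (inf_le_left.trans i : W ⊓ W' ≤ U) s' = res M (inf_le_left.trans j) t' := by
    rw [← res_res M i' inf_le_right, e', res_res]
  rw [← germFun_resFun x (inf_le_left.trans i : W ⊓ W' ≤ U) hx, ← b.form_res, e₁, e₂, b.form_res,
    germFun_resFun]

/-- The value of the form induced on the stalk: `b(s_x, t_x) = b(s, t)_x`. -/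
def SymmForm.stalkVal (a a' : stalk M x) : X.presheaf.stalk x :=
  germFun x (exists_germ₂ M x a a').choose_spec.choose
    (b.form _ (exists_germ₂ M x a a').choose_spec.choose_spec.choose
      (exists_germ₂ M x a a').choose_spec.choose_spec.choose_spec.choose)

lemma SymmForm.stalkVal_germ {U : X.Opens} (hx : x ∈ U) (s t : M.obj (op U)) :
    b.stalkVal x (germ M x hx s) (germ M x hx t) = germFun x hx (b.form U s t) := by
  have h := (exists_germ₂ M x (germ M x hx s)
    (germ M x hx t)).choose_spec.choose_spec.choose_spec.choose_spec
  exact b.germ_form_congr x _ _ _ _ _ _ h.1 h.2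

lemma SymmForm.stalkVal_symm (a a' : stalk M x) : b.stalkVal x a a' = b.stalkVal x a' a := by
  obtain ⟨U, hU, s, t, rfl, rfl⟩ := exists_germ₂ M x a a'
  rw [stalkVal_germ, stalkVal_germ, b.symm]

lemma SymmForm.stalkVal_add (a₁ a₂ a' : stalk M x) :
    b.stalkVal x (a₁ + a₂) a' = b.stalkVal x a₁ a' + b.stalkVal x a₂ a' := by
  obtain ⟨U, hU, s₁, s₂, rfl, rfl⟩ := exists_germ₂ M x a₁ a₂
  obtain ⟨V, hV, t, rfl⟩ := exists_germ M x a'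
  have hx : x ∈ U ⊓ V := ⟨hU, hV⟩
  rw [← germ_res M x (inf_le_left : U ⊓ V ≤ U) hx, ← germ_res M x (inf_le_left : U ⊓ V ≤ U) hx,
    ← germ_res M x (inf_le_right : U ⊓ V ≤ V) hx, ← germ_add]
  simp only [stalkVal_germ, map_add, LinearMap.add_apply]

lemma SymmForm.stalkVal_smul (c : X.presheaf.stalk x) (a a' : stalk M x) :
    b.stalkVal x (c • a) a' = c * b.stalkVal x a a' := by
  obtain ⟨U, hU, s, t, rfl, rfl⟩ := exists_germ₂ M x a a'
  obtain ⟨V, hV, f, rfl⟩ := TopCat.Presheaf.exists_germ_eq X.presheaf c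
  have hx : x ∈ U ⊓ V := ⟨hU, hV⟩
  change b.stalkVal x (germFun x hV f • _) _ = germFun x hV f * _
  rw [← germ_res M x (inf_le_left : U ⊓ V ≤ U) hx, ← germ_res M x (inf_le_left : U ⊓ V ≤ U) hx,
    ← germFun_resFun x (inf_le_right : U ⊓ V ≤ V) hx, ← germ_smul]
  simp only [stalkVal_germ, map_smul, LinearMap.smul_apply, smul_eq_mul, map_mul]

/-- The `𝒪_{X,x}`-bilinear form on the stalk at `x` induced by a form `b`. -/
def SymmForm.stalkForm : LinearMap.BilinForm (X.presheaf.stalk x) (stalk M x) :=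
  LinearMap.mk₂ _ (b.stalkVal x) (b.stalkVal_add x) (b.stalkVal_smul x)
    (fun a a₁ a₂ => by
      rw [stalkVal_symm, stalkVal_add, b.stalkVal_symm x a₁, b.stalkVal_symm x a₂])
    (fun c a a' => by
      rw [stalkVal_symm, stalkVal_smul, b.stalkVal_symm x a', smul_eq_mul])

end stalkForm

/-- The ring `𝒪_{X,x} / 𝔪_x²`; for a point of a smooth curve over `K` this is the ring `K[ε]`. -/
abbrev DualNumbersAt {X : Scheme.{u}} (x : X) : Type u :=
  X.presheaf.stalk x ⧸ IsLocalRing.maximalIdeal (X.presheaf.stalk x) ^ 2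

/-- `M_{2x} = 𝒪_{X,x} / 𝔪_x² ⊗ M_x`, a module over `𝒪_{X,x} / 𝔪_x²`. -/
abbrev doubleFiber {X : Scheme.{u}} (M : PreMod X) (x : X) : Type u :=
  DualNumbersAt x ⊗[X.presheaf.stalk x] stalk M x

/-- The restriction to `M_{2x}` of a form on `M`. -/
def SymmForm.doubleForm {X : Scheme.{u}} {M : PreMod X} (b : SymmForm M) (x : X) :
    LinearMap.BilinForm (DualNumbersAt x) (doubleFiber M x) :=
  LinearMap.BilinForm.baseChange (DualNumbersAt x) (b.stalkForm x)

/-- The ring homomorphism `K → 𝒪_{X,x} / 𝔪_x²` given by the structure morphism `X → Spec K`. -/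
def baseToDualNumbers {K : Type u} [Field K] {X : Scheme.{u}} (p : X ⟶ Spec (CommRingCat.of K))
    (x : X) : K →+* DualNumbersAt x :=
  (Ideal.Quotient.mk _).comp ((germFun x (U := ⊤) trivial).comp
    (p.appTop.hom.comp (Scheme.ΓSpecIso (CommRingCat.of K)).inv.hom))

/-- The dimension over `K` of an `𝒪_{X,x} / 𝔪_x²`-submodule of `M_{2x}`. -/
def dimOverBase {K : Type u} [Field K] {X : Scheme.{u}} (p : X ⟶ Spec (CommRingCat.of K))
    {M : PreMod X} {x : X} (L : Submodule (DualNumbersAt x) (doubleFiber M x)) : ℕ :=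
  @Module.finrank K L _ _ (Module.compHom L (baseToDualNumbers p x))

/-- `L ⊆ M_{2x}` is Lagrangian, where `M` is a bundle of rank `r` with a form `b`: it is isotropic
for the quadratic form `v ↦ b(v, v)`, and its dimension over `K` is `r`. -/
structure IsLagrangian {K : Type u} [Field K] {X : Scheme.{u}} (p : X ⟶ Spec (CommRingCat.of K))
    {M : PreMod X} (b : SymmForm M) (r : ℕ) {x : X}
    (L : Submodule (DualNumbersAt x) (doubleFiber M x)) : Prop where
  isotropic : ∀ v ∈ L, b.doubleForm x v v = 0
  dim_eq : dimOverBase p L = r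

/-- The class in `M_{2x}` of a section of `M` over a neighbourhood of `x`. -/
def toDoubleFiber {X : Scheme.{u}} (M : PreMod X) (x : X) {U : X.Opens} (hx : x ∈ U)
    (s : M.obj (op U)) : doubleFiber M x :=
  1 ⊗ₜ germ M x hx s

lemma toDoubleFiber_smul {X : Scheme.{u}} (M : PreMod X) (x : X) {U : X.Opens} (hx : x ∈ U)
    (a : Γ(X, U)) (s : M.obj (op U)) : toDoubleFiber M x hx (a • s) =
      (Ideal.Quotient.mk _ (germFun x hx a) : DualNumbersAt x) • toDoubleFiber M x hx s := by
  rw [toDoubleFiber, germ_smul, TensorProduct.tmul_smul, toDoubleFiber]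
  rfl

lemma toDoubleFiber_res {X : Scheme.{u}} (M : PreMod X) (x : X) {U V : X.Opens} (h : V ≤ U)
    (hx : x ∈ V) (s : M.obj (op U)) :
    toDoubleFiber M x hx (res M h s) = toDoubleFiber M x (h hx) s := by
  rw [toDoubleFiber, germ_res, toDoubleFiber]

/-- The sections over `U` of `ker (M → M_{2x} / L)`, where `M_{2x} / L` is a skyscraper sheaf at
`x`: the sections of `M` whose class in `M_{2x}` lies in `L` (no condition if `x ∉ U`). -/
def heckeSections {X : Scheme.{u}} (M : PreMod X) (x : X)
    (L : Submodule (DualNumbersAt x) (doubleFiber M x)) (U : X.Opens) :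
    Submodule Γ(X, U) (M.obj (op U)) where
  carrier := {s | ∀ hx : x ∈ U, toDoubleFiber M x hx s ∈ L}
  zero_mem' hx := by
    rw [toDoubleFiber, germ_zero, TensorProduct.tmul_zero]
    exact L.zero_mem
  add_mem' {s t} hs ht hx := by
    rw [toDoubleFiber, germ_add, TensorProduct.tmul_add]
    exact L.add_mem (hs hx) (ht hx)
  smul_mem' a s hs hx := by
    rw [toDoubleFiber_smul]
    exact L.smul_mem _ (hs hx)

/-- The subsheaf `M' = ker (M → M_{2x} / L)` of `M`. -/
def heckeKernel {X : Scheme.{u}} (M : PreMod X) (x : X)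
    (L : Submodule (DualNumbersAt x) (doubleFiber M x)) : PresheafOfModules.Submodule M where
  obj U := heckeSections M x L U.unop
  map {U V} f := fun s hs hx => by
    have e : toDoubleFiber M x hx (res M f.unop.le s) ∈ L := by
      rw [toDoubleFiber_res]
      exact hs _
    exact e

/-- The functions on `U` that vanish at `x` (no condition if `x ∉ U`). -/
def idealSections {X : Scheme.{u}} (x : X) (U : X.Opens) : Ideal Γ(X, U) where
  carrier := {f | ∀ hx : x ∈ U,
    germFun x hx f ∈ IsLocalRing.maximalIdeal (X.presheaf.stalk x)}
  zero_mem' hx := by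
    rw [map_zero]
    exact Ideal.zero_mem _
  add_mem' {f g} hf hg hx := by
    rw [map_add]
    exact Ideal.add_mem _ (hf hx) (hg hx)
  smul_mem' a f hf hx := by
    rw [smul_eq_mul, map_mul]
    exact Ideal.mul_mem_left _ _ (hf hx)

/-- The ideal sheaf `𝓘_x` of the functions that vanish at `x`. -/
def idealSheaf {X : Scheme.{u}} (x : X) : PresheafOfModules.Submodule
    (PresheafOfModules.unit (X.presheaf ⋙ forget₂ CommRingCat.{u} RingCat.{u})) where
  obj U := idealSections x U.unop
  map {U V} f := fun (s : Γ(X, U.unop)) hs hx => by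
    have e : germFun x hx (resFun f.unop.le s) ∈
        IsLocalRing.maximalIdeal (X.presheaf.stalk x) := by
      rw [germFun_resFun]
      exact hs _
    exact e

/-- The line bundle `𝒪(x) = ℋom(𝓘_x, 𝒪_X)`. -/
def lineBundle {X : Scheme.{u}} (x : X) : PreMod X :=
  dual (idealSheaf x).toPresheafOfModules

/-- The presheaf tensor product `U ↦ M(U) ⊗ N(U)`. -/
def preTensor {X : Scheme.{u}} (M N : PreMod X) : PreMod X :=
  MonoidalCategoryStruct.tensorObj M N

/-- The tensor product of `𝒪_X`-modules: the sheaf associated to `U ↦ M(U) ⊗ N(U)`. -/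
def tensor {X : Scheme.{u}} (M N : PreMod X) : X.Modules :=
  (PresheafOfModules.sheafification (𝟙 X.ringCatSheaf.obj)).obj (preTensor M N)

/-- The canonical morphism from the presheaf `U ↦ M(U) ⊗ N(U)` to `M ⊗ N`. -/
def toTensor {X : Scheme.{u}} (M N : PreMod X) : preTensor M N ⟶ toPre (tensor M N) :=
  (PresheafOfModules.sheafificationAdjunction (𝟙 X.ringCatSheaf.obj)).unit.app (preTensor M N)

/-- The section `s ⊗ t` of `M ⊗ N` over `U`. -/
def tmul {X : Scheme.{u}} {M N : PreMod X} {U : X.Opens} (s : M.obj (op U)) (t : N.obj (op U)) :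
    (toPre (tensor M N)).obj (op U) :=
  (toTensor M N).app (op U) (s ⊗ₜ[Γ(X, U)] t)

/-- The Hecke transform `ℋ(E, L) = E' ⊗ 𝒪(x)`. -/
def heckeTransform {X : Scheme.{u}} (E : X.Modules) (x : X)
    (L : Submodule (DualNumbersAt x) (doubleFiber (toPre E) x)) : X.Modules :=
  tensor (heckeKernel (toPre E) x L).toPresheafOfModules (lineBundle x)

/-- A form `b'` on `ℋ(E, L) = E' ⊗ 𝒪(x)` is induced by the form `b` on `E` if
`b'(s ⊗ φ, t ⊗ ψ) = φ ψ b(s, t)` as rational functions. As `φ` and `ψ` are maps `𝓘_x → 𝒪_X`, this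
says `f g b'(s ⊗ φ, t ⊗ ψ) = φ(f) ψ(g) b(s, t)` for all functions `f`, `g` that vanish at `x`. -/
def IsInducedForm {X : Scheme.{u}} {E : X.Modules} {x : X}
    {L : Submodule (DualNumbersAt x) (doubleFiber (toPre E) x)} (b : SymmForm (toPre E))
    (b' : SymmForm (toPre (heckeTransform E x L))) : Prop :=
  ∀ (U : X.Opens) (s t : heckeSections (toPre E) x L U) (φ ψ : (lineBundle x).obj (op U))
    (V : X.Opens) (hV : V ≤ U) (f g : idealSections x V),
    f.1 * g.1 * resFun hV (b'.form U
      (tmul (M := (heckeKernel (toPre E) x L).toPresheafOfModules) s φ)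
      (tmul (M := (heckeKernel (toPre E) x L).toPresheafOfModules) t ψ)) =
    dualEval φ hV f * dualEval ψ hV g * resFun hV (b.form U s.1 t.1)

end

end OrthogonalHecke

/-! The question is local. Away from `x` the subsheaf `E'` equals `E` and `𝒪(x)` is generated by
`1`, so the transform is `E` with its own form. At `x` the stalk `O` of the structure sheaf is a
discrete valuation ring with uniformizer `t` and residue field `K`. Let `F` be the stalk of `E`, and
let `Λ ⊂ F` be the preimage of `L`, the stalk of `E'`. Since `t²F ⊂ Λ ⊂ F`, the lattice `Λ` is free
of full rank. As `𝒪(x)` is generated by `1/t`, the stalk of the transform is `t⁻¹Λ`, so everything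
reduces to showing that `t⁻²b` is integral and unimodular on `Λ`.

Integrality is isotropy of `L` together with polarization (`form_mem_of_isotropic`). For
unimodularity, choose a `K`-linear form on `O/𝔪²` that does not vanish on the class of `t`.
Composing the form on the double fibre with it gives a non-degenerate `K`-form on a space of
dimension `2r`, where `L` is isotropic of dimension `r` and hence its own orthogonal
(`mem_of_orthogonal_of_isotropic`). Thus `b(f, Λ) ⊂ 𝔪²` forces `f ∈ Λ`. A functional `ψ` on `Λ`,
precomposed with `t² : F → Λ`, is `b(f, ·)` for some `f`; then `f ∈ Λ`, and `t⁻²b(f, ·) = ψ` on `Λ`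
(`exists_gram_lattice`).

To globalize, the value of the new form on two sections is defined as the unique function that
agrees with `b` away from `x`; it exists because divisibility by `t²` can be tested at `x`
(`exists_isFormValue`). A basis of `Λ` spreads out to a neighbourhood
(`exists_heckeSections_basis`), and non-degeneracy follows from invertible Gram determinants
(`SymmForm.isNondegenerate_of_gram`). -/

namespace OrthogonalHecke

noncomputable section

/-! ### Gluing of sections and functions. -/

/-- Sections of `M` are determined locally, and locally unique sections with a property that is
stable under restriction glue. -/
structure HasGluing {X : Scheme.{u}} (M : PreMod X) : Prop where
  sep (V : X.Opens) (s s' : M.obj (op V))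
    (h : ∀ y ∈ V, ∃ (W : X.Opens) (hW : W ≤ V), y ∈ W ∧ res M hW s = res M hW s') : s = s'
  glue (V : X.Opens) (Q : ∀ W : X.Opens, W ≤ V → M.obj (op W) → Prop)
    (hres : ∀ (W W' : X.Opens) (hW : W ≤ V) (h : W' ≤ W) (s : M.obj (op W)),
      Q W hW s → Q W' (h.trans hW) (res M h s))
    (huniq : ∀ (W : X.Opens) (hW : W ≤ V) (s s' : M.obj (op W)), Q W hW s → Q W hW s' → s = s')
    (hloc : ∀ y ∈ V, ∃ (W : X.Opens) (hW : W ≤ V), y ∈ W ∧ ∃ s, Q W hW s) :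
    ∃ s : M.obj (op V), ∀ y ∈ V, ∃ (W : X.Opens) (hW : W ≤ V), y ∈ W ∧ Q W hW (res M hW s)

lemma hasGluing_of_isSheaf {X : Scheme.{u}} (M : PreMod X)
    (hM : TopCat.Presheaf.IsSheaf (C := Ab.{u}) (X := X.carrier) M.presheaf) : HasGluing M where
  sep V s s' h := by
    choose W hW hy e using h
    refine TopCat.Sheaf.eq_of_locally_eq' (C := Ab.{u}) (X := X.carrier) ⟨M.presheaf, hM⟩
      (fun y : V => W y.1 y.2) V (fun y => homOfLE (hW _ _)) ?_ s s' (fun y => e y.1 y.2)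
    intro y hyV
    exact Opens.mem_iSup.2 ⟨⟨y, hyV⟩, hy y hyV⟩
  glue V Q hres huniq hloc := by
    choose W hW hy s hs using hloc
    obtain ⟨g, hg, -⟩ := TopCat.Sheaf.existsUnique_gluing' (C := Ab.{u}) (X := X.carrier)
      ⟨M.presheaf, hM⟩ (fun y : V => W y.1 y.2) V (fun y => homOfLE (hW _ _))
      (fun y hyV => Opens.mem_iSup.2 ⟨⟨y, hyV⟩, hy y hyV⟩) (fun y => s y.1 y.2) (by
        intro y z
        -- Compatibility on overlaps is automatic: both restrictions satisfy the property there, and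
        -- it has at most one solution.
        exact huniq _ (inf_le_left.trans (hW _ _)) _ _
          (hres _ _ (hW _ _) inf_le_left _ (hs y.1 y.2))
          (hres _ _ (hW _ _) inf_le_right _ (hs z.1 z.2)))
    refine ⟨g, fun y hyV => ⟨W y hyV, hW y hyV, hy y hyV, ?_⟩⟩
    have e : res M (hW y hyV) g = s y hyV := hg ⟨y, hyV⟩
    rw [e]
    exact hs y hyV

lemma hasGluing_modules {X : Scheme.{u}} (E : X.Modules) : HasGluing (toPre E) :=
  hasGluing_of_isSheaf _ E.isSheaf

/-- The structure sheaf as a presheaf of modules. -/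
abbrev unitMod (X : Scheme.{u}) : PreMod X :=
  PresheafOfModules.unit (X.presheaf ⋙ forget₂ CommRingCat.{u} RingCat.{u})

lemma hasGluing_unit (X : Scheme.{u}) : HasGluing (unitMod X) :=
  hasGluing_of_isSheaf _ (SheafOfModules.unit X.ringCatSheaf).isSheaf

section functions
variable {X : Scheme.{u}}

lemma fun_sep (V : X.Opens) (s s' : Γ(X, V))
    (h : ∀ y ∈ V, ∃ (W : X.Opens) (hW : W ≤ V), y ∈ W ∧ resFun hW s = resFun hW s') : s = s' :=
  (hasGluing_unit X).sep V s s' h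

lemma fun_glue (V : X.Opens) (Q : ∀ W : X.Opens, W ≤ V → Γ(X, W) → Prop)
    (hres : ∀ (W W' : X.Opens) (hW : W ≤ V) (h : W' ≤ W) (s : Γ(X, W)),
      Q W hW s → Q W' (h.trans hW) (resFun h s))
    (huniq : ∀ (W : X.Opens) (hW : W ≤ V) (s s' : Γ(X, W)), Q W hW s → Q W hW s' → s = s')
    (hloc : ∀ y ∈ V, ∃ (W : X.Opens) (hW : W ≤ V), y ∈ W ∧ ∃ s, Q W hW s) :
    ∃ s : Γ(X, V), ∀ y ∈ V, ∃ (W : X.Opens) (hW : W ≤ V), y ∈ W ∧ Q W hW (resFun hW s) :=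
  (hasGluing_unit X).glue V Q hres huniq hloc

lemma resFun_self {U : X.Opens} (a : Γ(X, U)) : resFun (le_refl U) a = a := by
  change (X.presheaf.map (𝟙 _)) a = a
  simp

lemma germFun_eq {x : X} {U : X.Opens} (hx : x ∈ U) (a b : Γ(X, U))
    (h : germFun x hx a = germFun x hx b) :
    ∃ (W : X.Opens) (hW : W ≤ U), x ∈ W ∧ resFun hW a = resFun hW b := by
  obtain ⟨W, hxW, i, j, e⟩ := X.presheaf.germ_eq x hx hx a b h
  exact ⟨W, i.le, hxW, e⟩

lemma exists_germFun (x : X) (a : X.presheaf.stalk x) :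
    ∃ (U : X.Opens) (hx : x ∈ U) (s : Γ(X, U)), germFun x hx s = a :=
  TopCat.Presheaf.exists_germ_eq X.presheaf a

end functions

lemma res_self {X : Scheme.{u}} (M : PreMod X) {U : X.Opens} (s : M.obj (op U)) :
    res M (le_refl U) s = s := by
  change M.presheaf.map (𝟙 _) s = s
  simp
  rfl

/-- A property of sections of `M` glues in the Hecke kernel. -/
lemma hasGluing_heckeKernel {X : Scheme.{u}} {M : PreMod X} (hM : HasGluing M) (x : X)
    (L : Submodule (DualNumbersAt x) (doubleFiber M x)) :
    HasGluing (heckeKernel M x L).toPresheafOfModules where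
  sep V s s' h := Subtype.ext <| hM.sep V s.1 s'.1 fun y hy => by
    obtain ⟨W, hW, hyW, e⟩ := h y hy
    exact ⟨W, hW, hyW, congrArg Subtype.val e⟩
  glue V Q hres huniq hloc := by
    -- Gluing takes place in `M`, with membership in the kernel made part of the property;
    -- membership is local because it only concerns the germ at `x`.
    obtain ⟨s, hs⟩ := hM.glue V
      (fun W hW s => ∃ h : s ∈ heckeSections M x L W, Q W hW (⟨s, h⟩ : heckeSections M x L W))
      (fun W W' hW h s ⟨hs, hQ⟩ => ⟨(heckeKernel M x L).map (homOfLE h).op hs, hres _ _ hW h _ hQ⟩)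
      (fun W hW s s' ⟨h, hQ⟩ ⟨h', hQ'⟩ => congrArg Subtype.val (huniq W hW _ _ hQ hQ'))
      (fun y hy => by
        obtain ⟨W, hW, hyW, s, hQ⟩ := hloc y hy
        exact ⟨W, hW, hyW, s.1, s.2, hQ⟩)
    refine ⟨(⟨s, fun hx => ?_⟩ : heckeSections M x L V), fun y hy => ?_⟩
    · obtain ⟨W, hW, hxW, h, -⟩ := hs x hx
      have := h hxW
      rwa [toDoubleFiber_res] at this
    · obtain ⟨W, hW, hyW, h, hQ⟩ := hs y hy
      exact ⟨W, hW, hyW, hQ⟩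

/-! ### Regularity of one-dimensional smooth local rings. -/

section commAlg
open IsLocalRing KaehlerDifferential

/-- A Noetherian local domain `O` that is a localization of a standard smooth `K`-algebra of
relative dimension one, with residue field `K`, is a discrete valuation ring. -/
theorem isDiscreteValuationRing_of_isStandardSmooth {K A O : Type*} [Field K] [CommRing A]
    [CommRing O] [Algebra K A] [Algebra K O] [Algebra A O] [IsScalarTower K A O]
    [Algebra.IsStandardSmoothOfRelativeDimension 1 K A] [IsDomain O] [IsLocalRing O]
    [IsNoetherianRing O] (S : Submonoid A) [IsLocalization S O]
    (h : Function.Surjective (algebraMap K (ResidueField O))) :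
    IsDiscreteValuationRing O := by
  have : Nontrivial A := (algebraMap A O).domain_nontrivial
  have : Algebra.IsStandardSmooth K A :=
    Algebra.IsStandardSmoothOfRelativeDimension.isStandardSmooth 1
  have : Algebra.FormallyEtale A O := Algebra.FormallyEtale.of_isLocalization S
  have hA : Module.finrank A (Ω[A⁄K]) = 1 := by
    rw [Module.finrank, Algebra.IsStandardSmoothOfRelativeDimension.rank_kaehlerDifferential 1]
    simp
  -- A localization is formally étale, so differentials of `O` are the base change of those of `A`.
  have hO : Module.finrank O (Ω[O⁄K]) = 1 := by
    rw [← (tensorKaehlerEquivOfFormallyEtale K A O).finrank_eq, Module.finrank_baseChange, hA]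
  have : Module.Free O (Ω[O⁄K]) :=
    Module.Free.of_equiv (tensorKaehlerEquivOfFormallyEtale K A O)
  have hk : Module.finrank (ResidueField O) (ResidueField O ⊗[O] Ω[O⁄K]) = 1 := by
    rw [Module.finrank_baseChange, hO]
  have hker : RingHom.ker (algebraMap O (ResidueField O)) = maximalIdeal O := ker_residue
  have hsurj : Function.Surjective (algebraMap O (ResidueField O)) := residue_surjective
  let e : K ≃ₐ[K] ResidueField O :=
    AlgEquiv.ofBijective (Algebra.ofId K _) ⟨(algebraMap K (ResidueField O)).injective, h⟩
  let g : ResidueField O →ₐ[K] O ⧸ RingHom.ker (algebraMap O (ResidueField O)) ^ 2 :=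
    (Algebra.ofId K _).comp e.symm.toAlgHom
  -- As `K` is the residue field, it splits `O/𝔪² → O/𝔪`. Such a section is the same as a retraction
  -- of `𝔪/𝔪² → k ⊗ Ω`, which is therefore injective; it is surjective because `Ω[k⁄K] = 0`.
  obtain ⟨l, hl⟩ := (retractionKerCotangentToTensorEquivSection (R := K) hsurj).symm ⟨g, by
    ext y
    obtain ⟨c, rfl⟩ := h y
    simp⟩
  have hinj : Function.Injective (kerCotangentToTensor K O (ResidueField O)) :=
    Function.LeftInverse.injective (g := l) (LinearMap.congr_fun hl)
  have : Subsingleton (Ω[(ResidueField O)⁄K]) := subsingleton_of_surjective _ _ h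
  have hsur : Function.Surjective (kerCotangentToTensor K O (ResidueField O)) := fun y =>
    (exact_kerCotangentToTensor_mapBaseChange K O (ResidueField O) hsurj y).1
      (Subsingleton.elim _ _)
  -- The kernel of the residue map equals the maximal ideal only propositionally, so the ideal is
  -- generalized before substituting.
  have key (I : Ideal O) (hI : I = maximalIdeal O)
      (f : I.Cotangent ≃ₗ[O] ResidueField O ⊗[O] Ω[O⁄K]) :
      Module.finrank (ResidueField O) (CotangentSpace O) = 1 := by
    subst hI
    rw [← hk]
    exact (f.extendScalarsOfSurjective (S := ResidueField O) hsurj).finrank_eq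
  exact finrank_CotangentSpace_eq_one_iff.1
    (key _ hker (LinearEquiv.ofBijective _ ⟨hinj, hsur⟩))

end commAlg

/-! ### Closed points of the curve: residue field, stalk, uniformizer. -/

section residueField
variable {K : Type u} [Field K] {X : Scheme.{u}} (p : X ⟶ Spec (CommRingCat.of K)) (x : X)

/-- The ring homomorphism `K → 𝒪_{X,x}` given by the structure morphism `X → Spec K`. -/
def baseToStalk : K →+* X.presheaf.stalk x :=
  (germFun x (U := ⊤) trivial).comp
    (p.appTop.hom.comp (Scheme.ΓSpecIso (CommRingCat.of K)).inv.hom)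

lemma fromSpecStalk_comp :
    X.fromSpecStalk x ≫ p = Spec.map (CommRingCat.ofHom (baseToStalk p x)) := by
  have h : CommRingCat.ofHom (baseToStalk p x) =
      (Scheme.ΓSpecIso (CommRingCat.of K)).inv ≫ p.appTop ≫ X.presheaf.germ ⊤ x trivial := rfl
  rw [h, Spec.map_comp, Spec.map_comp, ← Scheme.fromSpecStalk_toSpecΓ]
  simp only [Category.assoc]
  rw [← Scheme.toSpecΓ_naturality_assoc, ← Scheme.isoSpec_Spec_inv,
    Scheme.toSpecΓ_isoSpec_inv, Category.comp_id]

/-- This is the Nullstellensatz for a closed point, rewritten for the explicit map `baseToStalk`,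
which also defines the `K`-structure used for the dimension of `L`. -/
lemma residue_baseToStalk_bijective [IsAlgClosed K] [LocallyOfFiniteType p] (hx : IsClosed {x}) :
    Function.Bijective ((IsLocalRing.residue (X.presheaf.stalk x)).comp (baseToStalk p x)) := by
  have h : (residueFieldIsoBase p x hx).inv =
      CommRingCat.ofHom (baseToStalk p x) ≫ X.residue x := by
    apply Spec.map_injective
    rw [SpecMap_residueFieldIsoBase_inv, Spec.map_comp, ← fromSpecStalk_comp,
      Scheme.fromSpecResidueField, Category.assoc]
  have h' := ConcreteCategory.bijective_of_isIso (residueFieldIsoBase p x hx).inv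
  rw [h] at h'
  exact h'

/-- The stalk is the localization, at a prime, of a standard smooth chart of relative dimension one,
and its residue field is `K`; this is the situation of
`isDiscreteValuationRing_of_isStandardSmooth`. -/
theorem isDiscreteValuationRing_stalk [IsAlgClosed K] [IsIntegral X]
    [SmoothOfRelativeDimension 1 p] (hx : IsClosed {x}) :
    IsDiscreteValuationRing (X.presheaf.stalk x) := by
  have : Smooth p := SmoothOfRelativeDimension.smooth 1 p
  have : IsLocallyNoetherian X := LocallyOfFiniteType.isLocallyNoetherian p
  obtain ⟨U, hU, V, hV, hxV, e, hf⟩ :=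
    SmoothOfRelativeDimension.exists_isStandardSmoothOfRelativeDimension (n := 1) (f := p) x
  -- `Spec K` is a single point, so the chart on the base is everything.
  obtain rfl : U = ⊤ := by
    refine top_le_iff.1 fun y _ => ?_
    have : Subsingleton (Spec (CommRingCat.of K)) :=
      inferInstanceAs (Subsingleton (PrimeSpectrum K))
    rw [Subsingleton.elim y (p x)]
    exact e hxV
  let f : K →+* Γ(X, V) :=
    (p.appLE ⊤ V e).hom.comp (Scheme.ΓSpecIso (CommRingCat.of K)).inv.hom
  have hf' : f.IsStandardSmoothOfRelativeDimension 1 :=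
    hf.comp (.equiv (Scheme.ΓSpecIso (CommRingCat.of K)).symm.commRingCatIsoToRingEquiv)
  algebraize [f, baseToStalk p x]
  let _ := X.presheaf.algebra_section_stalk ⟨x, hxV⟩
  have := hV.isLocalization_stalk ⟨x, hxV⟩
  have : IsScalarTower K Γ(X, V) (X.presheaf.stalk x) := by
    refine IsScalarTower.of_algebraMap_eq fun c => ?_
    change germFun x _ (p.appTop _) = germFun x hxV (p.appLE ⊤ V e _)
    rw [Scheme.Hom.appLE, CommRingCat.comp_apply]
    exact (X.presheaf.germ_res_apply (homOfLE e) x hxV _).symm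
  exact isDiscreteValuationRing_of_isStandardSmooth (K := K)
    (hV.primeIdealOf ⟨x, hxV⟩).asIdeal.primeCompl (residue_baseToStalk_bijective p x hx).2

/-- A neighbourhood of a closed point of a smooth curve with a function that generates the maximal
ideal at the point and is invertible elsewhere. -/
theorem exists_uniformizer [IsLocallyNoetherian X] [IsDomain (X.presheaf.stalk x)]
    [IsDiscreteValuationRing (X.presheaf.stalk x)] (hx : IsClosed {x}) :
    ∃ (U : X.Opens) (hxU : x ∈ U) (t : Γ(X, U)), Irreducible (germFun x hxU t) ∧
      ∀ (y : X) (hy : y ∈ U), y ≠ x → IsUnit (germFun y hy t) := by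
  obtain ⟨V, hV, hxV, -⟩ := exists_isAffineOpen_mem_and_subset (U := (⊤ : X.Opens)) (x := x) trivial
  obtain ⟨a, ha⟩ := IsDiscreteValuationRing.exists_irreducible (X.presheaf.stalk x)
  obtain ⟨U, hxU, t, rfl⟩ := exists_germFun x a
  have hmem (y : X) (hy : y ∈ V) (f : Γ(X, V)) : f ∈ (hV.primeIdealOf ⟨y, hy⟩).asIdeal ↔
      germFun y hy f ∈ IsLocalRing.maximalIdeal (X.presheaf.stalk y) := by
    rw [hV.primeIdealOf_eq_map_closedPoint]
    rfl
  -- Each `f` in the prime of `x` is a multiple of `t` near `x`, so after shrinking every zero of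
  -- `t` is a zero of `f`. Finitely many `f` are handled by induction, and finitely many generate
  -- the prime.
  have hfin (s : Finset Γ(X, V)) : (∀ f ∈ s, f ∈ (hV.primeIdealOf ⟨x, hxV⟩).asIdeal) →
      ∃ (W : X.Opens) (_ : W ≤ U) (_ : W ≤ V), x ∈ W ∧ ∀ f ∈ s, ∀ (y : X) (hU : y ∈ U) (hV : y ∈ V),
        y ∈ W → germFun y hU t ∈ IsLocalRing.maximalIdeal (X.presheaf.stalk y) →
        germFun y hV f ∈ IsLocalRing.maximalIdeal (X.presheaf.stalk y) := by
    classical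
    induction s using Finset.induction_on with
    | empty => exact fun _ => ⟨U ⊓ V, inf_le_left, inf_le_right, ⟨hxU, hxV⟩, by simp⟩
    | insert f s _ ih =>
      intro hs
      obtain ⟨W, hWU, hWV, hxW, h⟩ := ih fun g hg => hs g (Finset.mem_insert_of_mem hg)
      have hf := (hmem x hxV f).1 (hs f (Finset.mem_insert_self _ _))
      rw [ha.maximalIdeal_eq, Ideal.mem_span_singleton] at hf
      obtain ⟨c, hc⟩ := hf
      obtain ⟨W', hxW', c, rfl⟩ := exists_germFun x c
      have hxI : x ∈ W ⊓ W' := ⟨hxW, hxW'⟩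
      rw [← germFun_resFun x (inf_le_left.trans hWV) hxI,
        ← germFun_resFun x (inf_le_left.trans hWU) hxI, ← germFun_resFun x inf_le_right hxI,
        ← map_mul] at hc
      obtain ⟨W₁, hW₁, hxW₁, e⟩ := germFun_eq hxI _ _ hc
      refine ⟨W₁, (hW₁.trans inf_le_left).trans hWU, (hW₁.trans inf_le_left).trans hWV, hxW₁,
        fun g hg y hU hV hyW ht => ?_⟩
      rcases Finset.mem_insert.1 hg with rfl | hg
      · rw [← germFun_resFun y (inf_le_left.trans hWV) (hW₁ hyW), ← germFun_resFun y hW₁ hyW, e,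
          germFun_resFun, map_mul, germFun_resFun]
        exact Ideal.mul_mem_right _ _ ht
      · exact h g hg y hU hV (hW₁ hyW).1 ht
  have : IsNoetherianRing Γ(X, V) := IsLocallyNoetherian.component_noetherian ⟨V, hV⟩
  obtain ⟨s, hs⟩ := (IsNoetherian.noetherian (hV.primeIdealOf ⟨x, hxV⟩).asIdeal)
  obtain ⟨W, hWU, hWV, hxW, h⟩ := hfin s fun f hf => hs ▸ Submodule.subset_span hf
  refine ⟨W, hxW, resFun hWU t, by rwa [germFun_resFun], fun y hy hyx => ?_⟩
  by_contra hu
  rw [germFun_resFun, ← mem_nonunits_iff, ← IsLocalRing.mem_maximalIdeal] at hu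
  -- A further zero `y` of `t` is a zero of all generators, hence a specialization of `x`; as `x` is
  -- closed, `y = x`.
  have hle : (hV.primeIdealOf ⟨x, hxV⟩).asIdeal ≤ (hV.primeIdealOf ⟨y, hWV hy⟩).asIdeal := by
    rw [← hs, Submodule.span_le]
    exact fun f hf => (hmem _ _ _).2 (h f hf y _ _ hy hu)
  have hsp := ((PrimeSpectrum.le_iff_specializes _ _).1 hle).map hV.fromSpec.continuous
  rw [hV.fromSpec_primeIdealOf, hV.fromSpec_primeIdealOf, specializes_iff_mem_closure,
    hx.closure_eq] at hsp
  exact hyx hsp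

end residueField

/-! ### Lagrangian submodules and lattices over a discrete valuation ring. -/

section lagrangian

/-- Over a two-dimensional algebra `A` with a linear form that does not vanish on any nonzero
ideal, a half-dimensional isotropic submodule for a non-degenerate form contains its orthogonal. -/
theorem mem_of_orthogonal_of_isotropic {K A V : Type*} [Field K] [CommRing A] [Nontrivial A]
    [Algebra K A]
    [AddCommGroup V] [Module A V] [Module.Free A V]
    [Module.Finite A V] (hA : Module.finrank K A = 2) (l : A →ₗ[K] K)
    (hl : ∀ a, (∀ c, l (c * a) = 0) → a = 0) (B : LinearMap.BilinForm A V)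
    (hsymm : ∀ v w, B v w = B w v) (hB : ∀ v, (∀ w, B v w = 0) → v = 0) (L : Submodule A V)
    (hiso : ∀ v ∈ L, ∀ w ∈ L, B v w = 0)
    (hdim : @Module.finrank K L _ _ (Module.compHom L (algebraMap K A)) = Module.finrank A V)
    (v : V)
    (hv : ∀ w ∈ L, B v w = 0) : v ∈ L := by
  let _ : Module K V := Module.compHom V (algebraMap K A)
  have : IsScalarTower K A V := ⟨fun c a v => by
    rw [Algebra.smul_def, mul_smul]; rfl⟩
  replace hdim : Module.finrank K (L.restrictScalars K) = Module.finrank A V := hdim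
  have hAf : Module.Finite K A := Module.finite_of_finrank_pos (by omega)
  have : Module.Finite K V := Module.Finite.trans A V
  have hlin (v : V) (c : K) (w : V) : B v (c • w) = c • B v w := by
    rw [← algebraMap_smul A c w, map_smul, algebraMap_smul]
  -- Composition with `l` turns an `A`-form into a `K`-form; the hypothesis on `l` is exactly what
  -- preserves non-degeneracy.
  let B' : LinearMap.BilinForm K V := LinearMap.mk₂ K (fun v w => l (B v w))
    (by simp) (fun c v w => by rw [hsymm, hlin, hsymm, map_smul]) (by simp)
    (fun c v w => by rw [hlin, map_smul])
  have hsymm' (v w) : B' v w = B' w v := congrArg l (hsymm v w)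
  have hsep (v : V) (h : ∀ w, B' v w = 0) : v = 0 := by
    refine hB v fun w => hl _ fun c => ?_
    rw [← smul_eq_mul, ← map_smul]
    exact h (c • w)
  have hnd : B'.Nondegenerate := ⟨hsep, fun w h => hsep w fun v => by rw [hsymm']; exact h v⟩
  have hle : L.restrictScalars K ≤ B'.orthogonal (L.restrictScalars K) := fun v hv w hw => by
    change l (B w v) = 0
    rw [hiso w hw v hv, map_zero]
  have hfr := LinearMap.BilinForm.finrank_orthogonal hnd (L.restrictScalars K)
  rw [← Module.finrank_mul_finrank K A V, hA, hdim] at hfr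
  -- With `dim V = 2 rank V` and `dim L = rank V`, the orthogonal of `L` has the same dimension as
  -- `L`.
  have heq := Submodule.eq_of_le_of_finrank_eq hle (by omega)
  have : v ∈ B'.orthogonal (L.restrictScalars K) := fun w hw => by
    change l (B w v) = 0
    rw [hsymm, hv w hw, map_zero]
  rw [← heq] at this
  exact this

variable {K O F : Type*} [Field K] [CommRing O] [IsDomain O] [IsDiscreteValuationRing O]

lemma exists_sub_mem_maximalIdeal (i : K →+* O)
    (hi : Function.Bijective ((IsLocalRing.residue O).comp i)) (a : O) :
    ∃ c : K, a - i c ∈ IsLocalRing.maximalIdeal O := by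
  obtain ⟨c, hc⟩ := hi.2 (IsLocalRing.residue O a)
  refine ⟨c, ?_⟩
  rw [← IsLocalRing.residue_eq_zero_iff, map_sub, sub_eq_zero]
  exact hc.symm

lemma eq_zero_of_mem_maximalIdeal (i : K →+* O)
    (hi : Function.Bijective ((IsLocalRing.residue O).comp i)) (c : K)
    (h : i c ∈ IsLocalRing.maximalIdeal O) : c = 0 := by
  rw [← IsLocalRing.residue_eq_zero_iff] at h
  exact (map_eq_zero_iff _ hi.1).1 h

/-- The classes of `1` and `t` form a `K`-basis: every element has a unique expansion `i a + i b *
t` modulo `t²`, because `i` identifies `K` with the residue field. -/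
lemma finrank_quotient_sq (i : K →+* O)
    (hi : Function.Bijective ((IsLocalRing.residue O).comp i))
    [Algebra K (O ⧸ IsLocalRing.maximalIdeal O ^ 2)]
    (halg : ∀ c, algebraMap K (O ⧸ IsLocalRing.maximalIdeal O ^ 2) c = Ideal.Quotient.mk _ (i c)) :
    Module.finrank K (O ⧸ IsLocalRing.maximalIdeal O ^ 2) = 2 := by
  obtain ⟨t, ht⟩ := IsDiscreteValuationRing.exists_irreducible O
  have hm := ht.maximalIdeal_eq
  have hm2 : IsLocalRing.maximalIdeal O ^ 2 = Ideal.span {t ^ 2} := by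
    rw [hm, Ideal.span_singleton_pow]
  let f : K × K →ₗ[K] O ⧸ IsLocalRing.maximalIdeal O ^ 2 :=
    (LinearMap.toSpanSingleton K _ 1).coprod
      (LinearMap.toSpanSingleton K _ (Ideal.Quotient.mk _ t))
  have hf (a b : K) : f (a, b) = Ideal.Quotient.mk _ (i a + i b * t) := by
    simp [f, Algebra.smul_def, halg]
  have hbij : Function.Bijective f := by
    constructor
    · rw [injective_iff_map_eq_zero]
      rintro ⟨a, b⟩ h
      rw [hf, Ideal.Quotient.eq_zero_iff_mem] at h
      have ha : a = 0 := by
        apply eq_zero_of_mem_maximalIdeal i hi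
        have h1 := Ideal.pow_le_self two_ne_zero h
        have h2 : i b * t ∈ IsLocalRing.maximalIdeal O := by
          rw [hm]; exact Ideal.mul_mem_left _ _ (Ideal.mem_span_singleton_self t)
        simpa using Ideal.sub_mem _ h1 h2
      subst ha
      have hb : b = 0 := by
        apply eq_zero_of_mem_maximalIdeal i hi
        rw [hm2, Ideal.mem_span_singleton] at h
        obtain ⟨c, hc⟩ := h
        rw [hm, Ideal.mem_span_singleton]
        refine ⟨c, mul_right_cancel₀ ht.ne_zero ?_⟩
        rw [map_zero, zero_add] at hc
        rw [hc]; ring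
      rw [hb]; rfl
    · intro y
      obtain ⟨a, rfl⟩ := Ideal.Quotient.mk_surjective y
      obtain ⟨c, hc⟩ := exists_sub_mem_maximalIdeal i hi a
      rw [hm, Ideal.mem_span_singleton] at hc
      obtain ⟨d, hd⟩ := hc
      obtain ⟨c', hc'⟩ := exists_sub_mem_maximalIdeal i hi d
      rw [hm, Ideal.mem_span_singleton] at hc'
      obtain ⟨d', hd'⟩ := hc'
      refine ⟨(c, c'), ?_⟩
      rw [hf, eq_comm, Ideal.Quotient.eq, hm2, Ideal.mem_span_singleton]
      refine ⟨d', ?_⟩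
      linear_combination hd + t * hd'
  rw [← (LinearEquiv.ofBijective f hbij).finrank_eq]
  simp

/-- Every nonzero ideal of `O/𝔪²` contains the class of `t`, so any `l` that is nonzero on this
class will do. -/
lemma exists_linearForm_quotient_sq [Algebra K (O ⧸ IsLocalRing.maximalIdeal O ^ 2)] :
    ∃ l : (O ⧸ IsLocalRing.maximalIdeal O ^ 2) →ₗ[K] K,
      ∀ a, (∀ c, l (c * a) = 0) → a = 0 := by
  obtain ⟨t, ht⟩ := IsDiscreteValuationRing.exists_irreducible O
  have hm2 : IsLocalRing.maximalIdeal O ^ 2 = Ideal.span {t ^ 2} := by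
    rw [ht.maximalIdeal_eq, Ideal.span_singleton_pow]
  have ht0 : (Ideal.Quotient.mk (IsLocalRing.maximalIdeal O ^ 2) t) ≠ 0 := by
    rw [Ne, Ideal.Quotient.eq_zero_iff_mem, hm2, Ideal.mem_span_singleton]
    rintro ⟨c, hc⟩
    refine ht.not_isUnit (IsUnit.of_mul_eq_one c (mul_left_cancel₀ ht.ne_zero ?_))
    rw [← mul_assoc, ← sq, ← hc, mul_one]
  obtain ⟨l, hl⟩ : ∃ l : Module.Dual K (O ⧸ IsLocalRing.maximalIdeal O ^ 2),
      l (Ideal.Quotient.mk _ t) ≠ 0 := by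
    by_contra! h
    exact ht0 ((Module.forall_dual_apply_eq_zero_iff K _).1 h)
  refine ⟨l, fun a ha => ?_⟩
  obtain ⟨a, rfl⟩ := Ideal.Quotient.mk_surjective a
  by_contra hne
  rw [Ideal.Quotient.eq_zero_iff_mem] at hne
  have ha0 : a ≠ 0 := fun h => hne (h ▸ Ideal.zero_mem _)
  obtain ⟨n, u, rfl⟩ := IsDiscreteValuationRing.eq_unit_mul_pow_irreducible ha0 ht
  have hn : n ≤ 1 := by
    by_contra! hn
    refine hne ?_
    rw [hm2, Ideal.mem_span_singleton]
    exact (pow_dvd_pow t hn).mul_left _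
  refine hl ?_
  -- A nonzero class is that of `u tⁿ` with `n ≤ 1`, and this multiplier carries it to `t`.
  have e : (↑u⁻¹ * t ^ (1 - n)) * (↑u * t ^ n) = t := by
    rw [show (↑u⁻¹ * t ^ (1 - n)) * (↑u * t ^ n) = (↑u⁻¹ * ↑u) * (t ^ (1 - n) * t ^ n) by ring,
      ← pow_add, Nat.sub_add_cancel hn, Units.inv_mul, one_mul, pow_one]
  rw [← e, map_mul]
  exact ha _

variable [AddCommGroup F] [Module O F] [Module.Free O F] [Module.Finite O F]
  (b : LinearMap.BilinForm O F)

/-- By unimodularity each coordinate of `f` in a basis is some `b g f`, hence lies in `I`. This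
gives non-degeneracy of the reduction modulo `I`. -/
lemma one_tmul_eq_zero {I : Ideal O} (f : F) (hb : Function.Surjective b)
    (h : ∀ g, b g f ∈ I) : (1 : O ⧸ I) ⊗ₜ[O] f = 0 := by
  let e := Module.finBasis O F
  rw [← e.sum_repr f, TensorProduct.tmul_sum]
  refine Finset.sum_eq_zero fun j _ => ?_
  obtain ⟨g, hg⟩ := hb (e.coord j)
  have hj : e.repr f j ∈ I := by
    rw [← e.coord_apply, ← hg]
    exact h g
  rw [TensorProduct.tmul_smul, TensorProduct.smul_tmul', Algebra.smul_def,
    Ideal.Quotient.algebraMap_eq, Ideal.Quotient.eq_zero_iff_mem.2 hj, zero_mul,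
    TensorProduct.zero_tmul]

lemma one_tmul_surjective {O F : Type*} [CommRing O] [AddCommGroup F] [Module O F]
    (I : Ideal O) (v : (O ⧸ I) ⊗[O] F) : ∃ f : F, 1 ⊗ₜ f = v := by
  induction v using TensorProduct.induction_on with
  | zero => exact ⟨0, TensorProduct.tmul_zero _ _⟩
  | tmul a f =>
    obtain ⟨a, rfl⟩ := Ideal.Quotient.mk_surjective a
    refine ⟨a • f, ?_⟩
    rw [TensorProduct.tmul_smul, TensorProduct.smul_tmul', Algebra.smul_def, mul_one]
    rfl
  | add v w hv hw =>
    obtain ⟨f, rfl⟩ := hv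
    obtain ⟨g, rfl⟩ := hw
    exact ⟨f + g, TensorProduct.tmul_add _ _ _⟩

lemma baseChange_one_tmul {O F : Type*} [CommRing O] [AddCommGroup F] [Module O F]
    (b : LinearMap.BilinForm O F) (I : Ideal O) (f g : F) :
    LinearMap.BilinForm.baseChange (O ⧸ I) b (1 ⊗ₜ f) (1 ⊗ₜ g) = Ideal.Quotient.mk I (b f g) := by
  rw [LinearMap.BilinForm.baseChange_tmul, Algebra.smul_def, mul_one, mul_one]
  rfl

variable (L : Submodule (O ⧸ IsLocalRing.maximalIdeal O ^ 2)
    ((O ⧸ IsLocalRing.maximalIdeal O ^ 2) ⊗[O] F))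

/-- Polarization: isotropy for the quadratic form gives isotropy for the bilinear form once `2` can
be divided out. The characteristic enters the proof only here. -/
lemma form_mem_of_isotropic {O F : Type*} [CommRing O] [IsLocalRing O] [AddCommGroup F]
    [Module O F] (b : LinearMap.BilinForm O F) (L : Submodule (O ⧸ IsLocalRing.maximalIdeal O ^ 2)
    ((O ⧸ IsLocalRing.maximalIdeal O ^ 2) ⊗[O] F)) (h2 : IsUnit (2 : O))
    (hsymm : ∀ f g, b f g = b g f)
    (hL : ∀ v ∈ L, LinearMap.BilinForm.baseChange _ b v v = 0) (f g : F) (hf : 1 ⊗ₜ f ∈ L)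
    (hg : 1 ⊗ₜ g ∈ L) : b f g ∈ IsLocalRing.maximalIdeal O ^ 2 := by
  have key (f : F) (hf : 1 ⊗ₜ f ∈ L) : b f f ∈ IsLocalRing.maximalIdeal O ^ 2 := by
    rw [← Ideal.Quotient.eq_zero_iff_mem, ← baseChange_one_tmul]
    exact hL _ hf
  have h := key (f + g) (by rw [TensorProduct.tmul_add]; exact L.add_mem hf hg)
  have e : b (f + g) (f + g) - b f f - b g g = b f g * 2 := by
    simp only [map_add, LinearMap.add_apply, hsymm g f]
    ring
  have h' := Ideal.sub_mem _ (Ideal.sub_mem _ h (key f hf)) (key g hg)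
  rw [e] at h'
  exact (Ideal.mul_unit_mem_iff_mem _ h2).1 h'

/-- The lattice given by a Lagrangian submodule is self-dual up to `𝔪²`. -/
theorem mem_of_forall_form_mem (i : K →+* O)
    (hi : Function.Bijective ((IsLocalRing.residue O).comp i))
    (h2 : IsUnit (2 : O)) (hsymm : ∀ f g, b f g = b g f) (hb : Function.Surjective b)
    (hL : ∀ v ∈ L, LinearMap.BilinForm.baseChange _ b v v = 0)
    (hdim : @Module.finrank K L _ _
      (Module.compHom L ((Ideal.Quotient.mk (IsLocalRing.maximalIdeal O ^ 2)).comp i)) =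
      Module.finrank O F) (f : F)
    (hf : ∀ g, 1 ⊗ₜ g ∈ L → b f g ∈ IsLocalRing.maximalIdeal O ^ 2) : 1 ⊗ₜ f ∈ L := by
  let _ : Algebra K (O ⧸ IsLocalRing.maximalIdeal O ^ 2) :=
    ((Ideal.Quotient.mk (IsLocalRing.maximalIdeal O ^ 2)).comp i).toAlgebra
  obtain ⟨l, hl⟩ := exists_linearForm_quotient_sq (K := K) (O := O)
  have : Nontrivial (O ⧸ IsLocalRing.maximalIdeal O ^ 2) := by
    rw [Ideal.Quotient.nontrivial_iff]
    exact fun h => (IsLocalRing.maximalIdeal.isMaximal O).ne_top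
      (top_le_iff.1 (h ▸ Ideal.pow_le_self two_ne_zero))
  refine mem_of_orthogonal_of_isotropic (K := K) (A := O ⧸ IsLocalRing.maximalIdeal O ^ 2)
    (V := (O ⧸ IsLocalRing.maximalIdeal O ^ 2) ⊗[O] F) (finrank_quotient_sq i hi fun _ => rfl) l hl
    (LinearMap.BilinForm.baseChange _ b) ?_ ?_ L ?_ ?_ _ ?_
  · intro v w
    obtain ⟨f, rfl⟩ := one_tmul_surjective _ v
    obtain ⟨g, rfl⟩ := one_tmul_surjective _ w
    rw [baseChange_one_tmul, baseChange_one_tmul, hsymm]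
  · intro v h
    obtain ⟨f, rfl⟩ := one_tmul_surjective _ v
    refine one_tmul_eq_zero b f hb fun g => ?_
    rw [hsymm, ← Ideal.Quotient.eq_zero_iff_mem, ← baseChange_one_tmul]
    exact h _
  · intro v hv w hw
    obtain ⟨f, rfl⟩ := one_tmul_surjective _ v
    obtain ⟨g, rfl⟩ := one_tmul_surjective _ w
    rw [baseChange_one_tmul, Ideal.Quotient.eq_zero_iff_mem]
    exact form_mem_of_isotropic b L h2 hsymm hL f g hv hw
  · rw [Module.finrank_baseChange]
    exact hdim
  · intro w hw
    obtain ⟨g, rfl⟩ := one_tmul_surjective _ w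
    rw [baseChange_one_tmul, Ideal.Quotient.eq_zero_iff_mem]
    exact hf g hw

/-- The preimage in `F` of a submodule of `O / 𝔪² ⊗ F`. -/
def lattice {O F : Type*} [CommRing O] [IsLocalRing O] [AddCommGroup F] [Module O F]
    (L : Submodule (O ⧸ IsLocalRing.maximalIdeal O ^ 2)
      ((O ⧸ IsLocalRing.maximalIdeal O ^ 2) ⊗[O] F)) : Submodule O F :=
  (L.restrictScalars O).comap (TensorProduct.mk O _ F 1)

lemma mem_lattice {O F : Type*} [CommRing O] [IsLocalRing O] [AddCommGroup F] [Module O F]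
    {L : Submodule (O ⧸ IsLocalRing.maximalIdeal O ^ 2)
      ((O ⧸ IsLocalRing.maximalIdeal O ^ 2) ⊗[O] F)} {f : F} : f ∈ lattice L ↔ 1 ⊗ₜ f ∈ L :=
  Iff.rfl

lemma smul_mem_lattice {O F : Type*} [CommRing O] [IsLocalRing O] [AddCommGroup F] [Module O F]
    (L : Submodule (O ⧸ IsLocalRing.maximalIdeal O ^ 2)
      ((O ⧸ IsLocalRing.maximalIdeal O ^ 2) ⊗[O] F)) {a : O}
    (ha : a ∈ IsLocalRing.maximalIdeal O ^ 2) (f : F) : a • f ∈ lattice L := by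
  rw [mem_lattice, TensorProduct.tmul_smul, TensorProduct.smul_tmul', Algebra.smul_def,
    Ideal.Quotient.algebraMap_eq, Ideal.Quotient.eq_zero_iff_mem.2 ha, zero_mul,
    TensorProduct.zero_tmul]
  exact L.zero_mem

/-- The lattice lies between `t²F` and `F`, and multiplication by `t²` embeds `F` into it. -/
lemma finrank_lattice : Module.finrank O (lattice L) = Module.finrank O F := by
  obtain ⟨t, ht⟩ := IsDiscreteValuationRing.exists_irreducible O
  have hm2 : t ^ 2 ∈ IsLocalRing.maximalIdeal O ^ 2 :=
    Ideal.pow_mem_pow (ht.maximalIdeal_eq ▸ Ideal.mem_span_singleton_self t) 2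
  refine le_antisymm (Submodule.finrank_le _) ?_
  refine LinearMap.finrank_le_finrank_of_injective
    (f := (LinearMap.lsmul O F (t ^ 2)).codRestrict (lattice L)
      fun f => smul_mem_lattice L hm2 f) ?_
  rw [injective_iff_map_eq_zero]
  intro f hf
  exact (smul_eq_zero.1 (congrArg Subtype.val hf)).resolve_left (pow_ne_zero 2 ht.ne_zero)

/-- The form `t⁻² b` on the lattice given by a Lagrangian submodule is unimodular. -/
theorem exists_gram_lattice {K : Type*} [Field K] (i : K →+* O)
    (hi : Function.Bijective ((IsLocalRing.residue O).comp i))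
    (h2 : IsUnit (2 : O)) (hsymm : ∀ f g, b f g = b g f) (hb : Function.Surjective b)
    (hL : ∀ v ∈ L, LinearMap.BilinForm.baseChange _ b v v = 0)
    (hdim : @Module.finrank K L _ _
        (Module.compHom L ((Ideal.Quotient.mk (IsLocalRing.maximalIdeal O ^ 2)).comp i)) =
      Module.finrank O F) {t : O} (ht : Irreducible t) {ι : Type*} [Fintype ι] [DecidableEq ι]
    (n : Module.Basis ι O (lattice L)) (G : Matrix ι ι O)
    (hG : ∀ j k, b (n j) (n k) = t ^ 2 * G j k) : IsUnit G.det := by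
  have hm2 : IsLocalRing.maximalIdeal O ^ 2 = Ideal.span {t ^ 2} := by
    rw [ht.maximalIdeal_eq, Ideal.span_singleton_pow]
  have htm : t ^ 2 ∈ IsLocalRing.maximalIdeal O ^ 2 := hm2 ▸ Ideal.mem_span_singleton_self _
  have key (ψ : lattice L →ₗ[O] O) : ∃ m : lattice L, ∀ m' : lattice L,
      b m m' = t ^ 2 * ψ m' := by
    -- `ψ` need not extend to `F`, but `ψ ∘ t²` is defined on all of `F`. Its representative `f`
    -- pairs with the lattice into `𝔪²`, so self-duality puts `f` in the lattice.
    obtain ⟨f, hf⟩ := hb (ψ ∘ₗ (LinearMap.lsmul O F (t ^ 2)).codRestrict (lattice L)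
      fun f => smul_mem_lattice L htm f)
    have hf' (m : lattice L) : b f m = t ^ 2 * ψ m := by
      rw [hf, ← smul_eq_mul, ← map_smul]
      rfl
    refine ⟨⟨f, mem_of_forall_form_mem b L i hi h2 hsymm hb hL hdim f fun g hg => ?_⟩, hf'⟩
    rw [hf' ⟨g, hg⟩]
    exact Ideal.mul_mem_right _ _ htm
  choose m hm using fun j => key (n.coord j)
  -- The rows are the coordinates of the vectors dual to `n` for `t⁻²b`, so `C` is the inverse of
  -- `G`.
  let C : Matrix ι ι O := fun j k => n.repr (m j) k
  have hC : C * G = 1 := by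
    ext j k
    refine mul_left_cancel₀ (pow_ne_zero 2 ht.ne_zero) ?_
    have h1 : b (m j) (n k) = ∑ l, C j l * b (n l) (n k) := by
      conv_lhs => rw [← n.sum_repr (m j)]
      simp only [Submodule.coe_sum, Submodule.coe_smul, map_sum, map_smul, LinearMap.sum_apply,
        LinearMap.smul_apply, smul_eq_mul, C]
    rw [Matrix.mul_apply, Finset.mul_sum]
    calc ∑ l, t ^ 2 * (C j l * G l k) = ∑ l, C j l * b (n l) (n k) := by
          refine Finset.sum_congr rfl fun l _ => ?_
          rw [hG]; ring
      _ = t ^ 2 * (1 : Matrix ι ι O) j k := by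
          rw [← h1, hm, n.coord_apply, n.repr_self, Finsupp.single_apply, Matrix.one_apply]
          simp only [eq_comm]
  exact Matrix.isUnit_det_of_left_inverse hC

end lagrangian

/-! ### Local bases of a presheaf of modules and their germs. -/

section localBasis
variable {X : Scheme.{u}} {M : PreMod X} {ι : Type*} [Fintype ι]

/-- The sections `e i ∈ M(U)` induce an isomorphism `𝒪_U^ι ≅ M|_U`. -/
def IsLocalBasis (M : PreMod X) (U : X.Opens) (e : ι → M.obj (op U)) : Prop :=
  ∀ (V : X.Opens) (hV : V ≤ U), Function.Bijective
    (fun c : ι → Γ(X, V) => ∑ i, c i • (res M hV (e i) : M.obj (op V)))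

lemma IsLocalBasis.restrict {U V : X.Opens} {e : ι → M.obj (op U)} (he : IsLocalBasis M U e)
    (hV : V ≤ U) : IsLocalBasis M V (fun i => res M hV (e i)) := fun W hW => by
  simpa only [res_res] using he W (hW.trans hV)

lemma res_sum_smul {U V : X.Opens} (hV : V ≤ U) (c : ι → Γ(X, U)) (s : ι → M.obj (op U)) :
    res M hV (∑ i, c i • s i) = ∑ i, resFun hV (c i) • res M hV (s i) := by
  rw [map_sum]
  exact Finset.sum_congr rfl fun i _ => map_smulₛₗ (res M hV) (c i) (s i)

lemma germ_sum_smul {U : X.Opens} {x : X} (hx : x ∈ U) (c : ι → Γ(X, U)) (s : ι → M.obj (op U)) :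
    germ M x hx (∑ i, c i • s i) = ∑ i, germFun x hx (c i) • germ M x hx (s i) := by
  have h : germ M x hx (∑ i, c i • s i) = ∑ i, germ M x hx (c i • s i) :=
    map_sum (TopCat.Presheaf.germ (C := Ab.{u}) (X := X.carrier) M.presheaf U x hx).hom _ _
  rw [h]
  exact Finset.sum_congr rfl fun i _ => germ_smul M x hx (c i) (s i)

lemma IsLocalBasis.exists_coord {U V : X.Opens} {e : ι → M.obj (op U)} (he : IsLocalBasis M U e)
    (hV : V ≤ U) (s : M.obj (op V)) : ∃ c : ι → Γ(X, V), s = ∑ i, c i • res M hV (e i) := by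
  obtain ⟨c, hc⟩ := (he V hV).2 s
  exact ⟨c, hc.symm⟩

lemma IsLocalBasis.coord_ext {U V : X.Opens} {e : ι → M.obj (op U)} (he : IsLocalBasis M U e)
    (hV : V ≤ U) {c d : ι → Γ(X, V)}
    (h : ∑ i, c i • res M hV (e i) = ∑ i, d i • res M hV (e i)) : c = d :=
  (he V hV).1 h

/-- A finite family of opens containing `x` contains a common open neighbourhood of `x`. -/
lemma exists_common_nhd (x : X) (U : ι → X.Opens) (hU : ∀ i, x ∈ U i) (U₀ : X.Opens)
    (hU₀ : x ∈ U₀) : ∃ W : X.Opens, x ∈ W ∧ W ≤ U₀ ∧ ∀ i, W ≤ U i := by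
  refine ⟨⟨U₀ ∩ ⋂ i, U i, U₀.isOpen.inter (isOpen_iInter_of_finite fun i => (U i).isOpen)⟩,
    ⟨hU₀, Set.mem_iInter.2 hU⟩, fun y hy => hy.1, fun i y hy => Set.mem_iInter.1 hy.2 i⟩

lemma exists_germFun_family (x : X) (a : ι → X.presheaf.stalk x) (U₀ : X.Opens) (hU₀ : x ∈ U₀) :
    ∃ (W : X.Opens) (hx : x ∈ W) (_ : W ≤ U₀) (s : ι → Γ(X, W)), ∀ i, germFun x hx (s i) = a i := by
  choose U hU s hs using fun i => exists_germFun x (a i)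
  obtain ⟨W, hW, hW₀, hWU⟩ := exists_common_nhd x U hU U₀ hU₀
  exact ⟨W, hW, hW₀, fun i => resFun (hWU i) (s i), fun i => by rw [germFun_resFun, hs]⟩

lemma exists_germ_family (x : X) (a : ι → stalk M x) (U₀ : X.Opens) (hU₀ : x ∈ U₀) :
    ∃ (W : X.Opens) (hx : x ∈ W) (_ : W ≤ U₀) (s : ι → M.obj (op W)),
      ∀ i, germ M x hx (s i) = a i := by
  choose U hU s hs using fun i => exists_germ M x (a i)
  obtain ⟨W, hW, hW₀, hWU⟩ := exists_common_nhd x U hU U₀ hU₀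
  exact ⟨W, hW, hW₀, fun i => res M (hWU i) (s i), fun i => by rw [germ_res, hs]⟩

lemma exists_nhd_res_eq {x : X} {U : X.Opens} (hx : x ∈ U) (s t : ι → M.obj (op U))
    (h : ∀ i, germ M x hx (s i) = germ M x hx (t i)) :
    ∃ (W : X.Opens) (hW : W ≤ U), x ∈ W ∧ ∀ i, res M hW (s i) = res M hW (t i) := by
  choose W hW h₁ h₂ e using fun i => germ_eq M x hx hx _ _ (h i)
  obtain ⟨W', hxW', hW'U, hW'⟩ := exists_common_nhd x W hW U hx
  refine ⟨W', hW'U, hxW', fun i => ?_⟩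
  rw [← res_res M (h₁ i) (hW' i), e, res_res]

lemma exists_nhd_resFun_eq {x : X} {U : X.Opens} (hx : x ∈ U) (s t : ι → Γ(X, U))
    (h : ∀ i, germFun x hx (s i) = germFun x hx (t i)) :
    ∃ (W : X.Opens) (hW : W ≤ U), x ∈ W ∧ ∀ i, resFun hW (s i) = resFun hW (t i) := by
  choose W hW hxW e using fun i => germFun_eq hx _ _ (h i)
  obtain ⟨W', hxW', hW'U, hW'⟩ := exists_common_nhd x W hxW U hx
  refine ⟨W', hW'U, hxW', fun i => ?_⟩
  rw [← resFun_resFun (hW i) (hW' i), e, resFun_resFun]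

/-- The basis of the stalk given by a local basis. -/
lemma IsLocalBasis.exists_stalkBasis {U : X.Opens} {e : ι → M.obj (op U)}
    (he : IsLocalBasis M U e) {x : X} (hx : x ∈ U) :
    ∃ B : Module.Basis ι (X.presheaf.stalk x) (stalk M x), ∀ i, B i = germ M x hx (e i) := by
  have hli : LinearIndependent (X.presheaf.stalk x) (fun i => germ M x hx (e i)) := by
    rw [Fintype.linearIndependent_iff]
    intro g hg
    -- A relation between germs lifts to functions and holds on some neighbourhood, where the local
    -- basis makes it trivial.
    obtain ⟨W, hxW, hWU, c, hc⟩ := exists_germFun_family x g U hx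
    have h0 : germ M x hxW (∑ i, c i • res M hWU (e i)) = germ M x hxW 0 := by
      rw [germ_sum_smul, germ_zero, ← hg]
      simp only [hc, germ_res]
    obtain ⟨W', hxW', h₁, h₂, h'⟩ := germ_eq M x hxW hxW _ _ h0
    rw [res_sum_smul, map_zero] at h'
    have hz := he.coord_ext (h₁.trans hWU) (c := fun i => resFun h₁ (c i)) (d := 0) (by
      simpa only [res_res, Pi.zero_apply, zero_smul, Finset.sum_const_zero] using h')
    intro i
    rw [← hc, ← germFun_resFun x h₁ hxW', congrFun hz i, Pi.zero_apply, map_zero]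
  refine ⟨Module.Basis.mk hli ?_, fun i => Module.Basis.mk_apply _ _ i⟩
  intro a _
  obtain ⟨V, hxV, s, rfl⟩ := exists_germ M x a
  have hxI : x ∈ U ⊓ V := ⟨hx, hxV⟩
  obtain ⟨c, hc⟩ := he.exists_coord inf_le_left (res M (inf_le_right : U ⊓ V ≤ V) s)
  rw [← germ_res M x (inf_le_right : U ⊓ V ≤ V) hxI, hc, germ_sum_smul]
  refine Submodule.sum_mem _ fun i _ => Submodule.smul_mem _ _ (Submodule.subset_span ⟨i, ?_⟩)
  rw [germ_res]

end localBasis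

/-! ### Gram matrices and non-degeneracy. -/

section gram
variable {X : Scheme.{u}} {M : PreMod X} {ι : Type*} [Fintype ι] (b : SymmForm M)

/-- The Gram matrix of a family of sections. -/
def SymmForm.gram (U : X.Opens) (e : ι → M.obj (op U)) : Matrix ι ι Γ(X, U) :=
  Matrix.of fun i j => b.form U (e i) (e j)

lemma SymmForm.form_sum_res {U V : X.Opens} (hV : V ≤ U) (e : ι → M.obj (op U))
    (c : ι → Γ(X, V)) (j : ι) :
    b.form V (∑ i, c i • res M hV (e i)) (res M hV (e j)) =
      Matrix.vecMul c ((b.gram U e).map (resFun hV)) j := by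
  simp only [map_sum, map_smul, LinearMap.sum_apply, LinearMap.smul_apply, b.form_res, smul_eq_mul,
    Matrix.vecMul, dotProduct, Matrix.map_apply, gram, Matrix.of_apply]

variable [DecidableEq ι]

lemma isUnit_det_map {R S : Type*} [CommRing R] [CommRing S] (f : R →+* S) {A : Matrix ι ι R}
    (h : IsUnit A.det) : IsUnit (A.map f).det := by
  have := h.map f
  rwa [RingHom.map_det] at this

/-- In coordinates, pairing with the basis is right multiplication by the Gram matrix, and
invertibility of this matrix survives restriction. -/
lemma SymmForm.eq_of_form_eq {U V : X.Opens} {e : ι → M.obj (op U)} (he : IsLocalBasis M U e)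
    (hdet : IsUnit (b.gram U e).det) (hV : V ≤ U) {s s' : M.obj (op V)}
    (h : ∀ j, b.form V s (res M hV (e j)) = b.form V s' (res M hV (e j))) : s = s' := by
  obtain ⟨c, rfl⟩ := he.exists_coord hV s
  obtain ⟨c', rfl⟩ := he.exists_coord hV s'
  have hu := (Matrix.isUnit_iff_isUnit_det _).2 (isUnit_det_map (resFun hV) hdet)
  have : c = c' := Matrix.vecMul_injective_of_isUnit hu (funext fun j => by
    beta_reduce
    rw [← b.form_sum_res, ← b.form_sum_res]; exact h j)
  rw [this]

lemma SymmForm.exists_form_eq {U V : X.Opens} {e : ι → M.obj (op U)}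
    (hdet : IsUnit (b.gram U e).det) (hV : V ≤ U) (a : ι → Γ(X, V)) :
    ∃ s : M.obj (op V), ∀ j, b.form V s (res M hV (e j)) = a j := by
  have hu := isUnit_det_map (resFun hV) hdet
  refine ⟨∑ i, Matrix.vecMul a ((b.gram U e).map (resFun hV))⁻¹ i • res M hV (e i), fun j => ?_⟩
  rw [b.form_sum_res, Matrix.vecMul_vecMul, Matrix.nonsing_inv_mul _ hu, Matrix.vecMul_one]

/-- A form whose Gram matrices for suitable local bases are invertible is non-degenerate. -/
theorem SymmForm.isNondegenerate_of_gram (hM : HasGluing M)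
    (h : ∀ y : X, ∃ (U : X.Opens) (_ : y ∈ U) (e : ι → M.obj (op U)),
      IsLocalBasis M U e ∧ IsUnit (b.gram U e).det) : b.IsNondegenerate := by
  have heval {U V : X.Opens} {s s' : M.obj (op U)} (hs : b.toDual U s = b.toDual U s')
      (hV : V ≤ U) (t : M.obj (op V)) : b.form V (res M hV s) t = b.form V (res M hV s') t := by
    have := congrArg (fun φ : dualSections M U => φ.1 ⟨V, hV⟩ t) hs
    exact this
  have hinj (U : X.Opens) : Function.Injective (b.toDual U) := fun s s' hs => by
    refine hM.sep U s s' fun y hy => ?_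
    obtain ⟨V, hyV, e, he, hdet⟩ := h y
    exact ⟨U ⊓ V, inf_le_left, ⟨hy, hyV⟩, b.eq_of_form_eq he hdet inf_le_right fun j =>
      heval hs inf_le_left _⟩
  refine fun U => ⟨hinj U, fun φ => ?_⟩
  obtain ⟨φ, rfl⟩ : ∃ ψ : dualSections M U, (show (dual M).obj (op U) from ψ) = φ := ⟨φ, rfl⟩
  -- The glued property is that `s` represents `φ` on every smaller open set. Injectivity makes `s`
  -- unique, and inverting the Gram matrix gives it locally.
  obtain ⟨s, hs⟩ := hM.glue U
    (fun W hW s => ∀ (V : X.Opens) (hV : V ≤ W) (t : M.obj (op V)),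
      b.form V (res M hV s) t = φ.1 ⟨V, hV.trans hW⟩ t)
    (fun W W' hW h s hs V hV t => by rw [res_res]; exact hs V (hV.trans h) t)
    (fun W hW s s' hs hs' => hinj W (Subtype.ext (funext fun V => LinearMap.ext fun t =>
      (hs V.1 V.2 t).trans (hs' V.1 V.2 t).symm)))
    (fun y hy => by
      obtain ⟨V, hyV, e, he, hdet⟩ := h y
      obtain ⟨s, hs⟩ := b.exists_form_eq hdet (inf_le_right : U ⊓ V ≤ V)
        (fun j => φ.1 ⟨U ⊓ V, inf_le_left⟩ (res M inf_le_right (e j)))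
      refine ⟨U ⊓ V, inf_le_left, ⟨hy, hyV⟩, s, fun W hW t => ?_⟩
      obtain ⟨c, rfl⟩ := he.exists_coord (hW.trans inf_le_right) t
      simp only [map_sum, map_smul]
      refine Finset.sum_congr rfl fun i _ => ?_
      rw [← res_res M inf_le_right hW (e i), b.form_res, hs,
        φ.2 ⟨U ⊓ V, inf_le_left⟩ ⟨W, hW.trans inf_le_left⟩ hW])
  refine ⟨s, Subtype.ext (funext fun V => LinearMap.ext fun t => ?_)⟩
  change b.form V.1 (res M V.2 s) t = φ.1 V t
  refine fun_sep V.1 _ _ fun y hy => ?_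
  obtain ⟨W, hW, hyW, hsW⟩ := hs y (V.2 hy)
  refine ⟨V.1 ⊓ W, inf_le_left, ⟨hy, hyW⟩, ?_⟩
  have := hsW (V.1 ⊓ W) inf_le_right (res M inf_le_left t)
  rw [res_res] at this
  rw [← φ.2 V ⟨V.1 ⊓ W, inf_le_left.trans V.2⟩ inf_le_left, ← this, ← b.form_res, res_res]

/-- The Gram matrix of a non-degenerate form for a local basis is invertible. -/
lemma SymmForm.IsNondegenerate.isUnit_gram {b : SymmForm M} (hb : b.IsNondegenerate)
    {U : X.Opens} {e : ι → M.obj (op U)} (he : IsLocalBasis M U e) :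
    IsUnit (b.gram U e).det := by
  let coord (V : X.Opens) (hV : V ≤ U) : M.obj (op V) ≃ₗ[Γ(X, V)] (ι → Γ(X, V)) :=
    (LinearEquiv.ofBijective (Fintype.linearCombination Γ(X, V) (fun i => res M hV (e i)))
      (he V hV)).symm
  have hcoord (V : X.Opens) (hV : V ≤ U) (c : ι → Γ(X, V)) :
      coord V hV (∑ i, c i • res M hV (e i)) = c := by
    rw [LinearEquiv.symm_apply_eq]
    rfl
  -- These are the coordinate functionals. Their preimages under `M → M^*` form the dual basis,
  -- whose coordinate matrix inverts the Gram matrix.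
  let φ (i : ι) : dualSections M U := ⟨fun V => LinearMap.proj i ∘ₗ (coord V.1 V.2).toLinearMap,
    fun V W h s => by
      obtain ⟨c, rfl⟩ := he.exists_coord V.2 s
      rw [res_sum_smul]
      simp only [res_res, LinearMap.comp_apply, LinearEquiv.coe_coe, LinearMap.proj_apply]
      rw [hcoord W.1 W.2, hcoord V.1 V.2]⟩
  choose s hs using fun i => (hb U).2 (φ i)
  choose c hc using fun i => he.exists_coord le_rfl (s i)
  refine Matrix.isUnit_det_of_left_inverse (B := Matrix.of c) ?_
  ext i j
  have h1 : b.form U (res M le_rfl (s i)) (res M le_rfl (e j)) = (φ i).1 ⟨U, le_rfl⟩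
      (res M le_rfl (e j)) :=
    congrArg (fun ψ : dualSections M U => ψ.1 ⟨U, le_rfl⟩ (res M le_rfl (e j))) (hs i)
  have h2 : (φ i).1 ⟨U, le_rfl⟩ (res M le_rfl (e j)) = (1 : Matrix ι ι Γ(X, U)) i j := by
    have : res M le_rfl (e j) =
        ∑ k, (Pi.single j 1 : ι → Γ(X, U)) k • res M le_rfl (e k) := by
      simp [Pi.single_apply, ite_smul]
    rw [this]
    change coord U le_rfl _ i = _
    rw [hcoord, Matrix.one_apply, Pi.single_apply]
  rw [← h2, ← h1, res_self M (s i), hc, b.form_sum_res]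
  simp only [Matrix.mul_apply, Matrix.vecMul, dotProduct, Matrix.of_apply, Matrix.map_apply,
    resFun_self]

/-- The form induced on the stalk is unimodular. -/
lemma SymmForm.stalkForm_surjective {U : X.Opens} {e : ι → M.obj (op U)}
    (he : IsLocalBasis M U e) (hdet : IsUnit (b.gram U e).det) {x : X} (hx : x ∈ U) :
    Function.Surjective (b.stalkForm x) := by
  obtain ⟨B, hB⟩ := he.exists_stalkBasis hx
  intro ψ
  let G := (b.gram U e).map (germFun x hx)
  have hG (i j : ι) : b.stalkForm x (B i) (B j) = G i j := by
    rw [hB, hB]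
    exact b.stalkVal_germ x hx _ _
  have hu : IsUnit G.det := isUnit_det_map (germFun x hx) hdet
  refine ⟨∑ i, Matrix.vecMul (fun j => ψ (B j)) G⁻¹ i • B i, B.ext fun j => ?_⟩
  have : b.stalkForm x (∑ i, Matrix.vecMul (fun j => ψ (B j)) G⁻¹ i • B i) (B j) =
      Matrix.vecMul (Matrix.vecMul (fun j => ψ (B j)) G⁻¹) G j := by
    simp only [map_sum, map_smul, LinearMap.sum_apply, LinearMap.smul_apply, hG, smul_eq_mul]
    rfl
  rw [this, Matrix.vecMul_vecMul, Matrix.nonsing_inv_mul _ hu, Matrix.vecMul_one]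

end gram

/-! ### The sheaf tensor product with an invertible factor. -/

section tensor
variable {X : Scheme.{u}} {M N : PreMod X}

/-- Sheafification identifies only sections that already agree on a cover. This and
`toTensor_locally_surjective` are what is needed about the sheaf tensor product. -/
lemma toTensor_locally_injective {V : X.Opens} (p q : (preTensor M N).obj (op V))
    (h : (toTensor M N).app (op V) p = (toTensor M N).app (op V) q) (y : X) (hy : y ∈ V) :
    ∃ (W : X.Opens) (hW : W ≤ V), y ∈ W ∧ res (preTensor M N) hW p = res (preTensor M N) hW q := by
  have hs := Presheaf.equalizerSieve_mem (Opens.grothendieckTopology X)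
    (CategoryTheory.toSheafify (Opens.grothendieckTopology X) (preTensor M N).presheaf) p q h
  obtain ⟨W, f, hf, hyW⟩ := hs y hy
  exact ⟨W, f.le, hyW, hf⟩

lemma toTensor_locally_surjective {V : X.Opens} (s : (toPre (tensor M N)).obj (op V)) (y : X)
    (hy : y ∈ V) : ∃ (W : X.Opens) (hW : W ≤ V), y ∈ W ∧
      ∃ p, (toTensor M N).app (op W) p = res (toPre (tensor M N)) hW s := by
  have hs := Presheaf.imageSieve_mem (Opens.grothendieckTopology X)
    (CategoryTheory.toSheafify (Opens.grothendieckTopology X) (preTensor M N).presheaf) s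
  obtain ⟨W, f, ⟨p, hp⟩, hyW⟩ := hs y hy
  exact ⟨W, f.le, hyW, p, hp⟩

lemma add_tmul {U : X.Opens} (s s' : M.obj (op U)) (t : N.obj (op U)) :
    tmul (s + s') t = tmul s t + tmul s' t := by
  rw [tmul, TensorProduct.add_tmul]
  exact map_add ((toTensor M N).app (op U)).hom _ _

lemma smul_tmul {U : X.Opens} (a : Γ(X, U)) (s : M.obj (op U)) (t : N.obj (op U)) :
    tmul (a • s) t = a • tmul s t := by
  rw [tmul, ← TensorProduct.smul_tmul']
  exact map_smul ((toTensor M N).app (op U)).hom a _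

lemma tmul_smul {U : X.Opens} (a : Γ(X, U)) (s : M.obj (op U)) (t : N.obj (op U)) :
    tmul s (a • t) = a • tmul s t := by
  rw [tmul, TensorProduct.tmul_smul]
  exact map_smul ((toTensor M N).app (op U)).hom a _

lemma res_toTensor {U V : X.Opens} (hV : V ≤ U) (p : (preTensor M N).obj (op U)) :
    res (toPre (tensor M N)) hV ((toTensor M N).app (op U) p) =
      (toTensor M N).app (op V) (res (preTensor M N) hV p) :=
  (PresheafOfModules.naturality_apply (toTensor M N) (homOfLE hV).op p).symm

lemma res_tmul {U V : X.Opens} (hV : V ≤ U) (s : M.obj (op U)) (t : N.obj (op U)) :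
    res (toPre (tensor M N)) hV (tmul s t) = tmul (res M hV s) (res N hV t) :=
  res_toTensor hV _

/-- The map is the composite `P ≅ P ⊗ R ≅ P ⊗ Q`, where `1 ↦ q`. -/
lemma tmul_bijective_of_generator {R P Q : Type*} [CommRing R] [AddCommGroup P] [AddCommGroup Q]
    [Module R P] [Module R Q] (q : Q) (hq : Function.Bijective (fun c : R => c • q)) :
    Function.Bijective (fun s : P => s ⊗ₜ[R] q) := by
  let e : R ≃ₗ[R] Q := LinearEquiv.ofBijective (LinearMap.toSpanSingleton R Q q) hq
  have h := ((TensorProduct.rid R P).symm.trans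
    (TensorProduct.congr (LinearEquiv.refl R P) e)).bijective
  have he : e 1 = q := one_smul R q
  have hfun : ⇑((TensorProduct.rid R P).symm.trans
      (TensorProduct.congr (LinearEquiv.refl R P) e)) = fun s : P => s ⊗ₜ[R] q := by
    ext s
    simp [he]
  rwa [hfun] at h

/-- The section `τ ∈ N(U)` induces an isomorphism `𝒪_U ≅ N|_U`. -/
def IsLocalGenerator (N : PreMod X) (U : X.Opens) (τ : N.obj (op U)) : Prop :=
  ∀ (V : X.Opens) (hV : V ≤ U), Function.Bijective
    (fun c : Γ(X, V) => (c • (res N hV τ : N.obj (op V)) : N.obj (op V)))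

lemma IsLocalGenerator.preTensor_bijective {U V : X.Opens} {τ : N.obj (op U)}
    (hτ : IsLocalGenerator N U τ) (hV : V ≤ U) : Function.Bijective
    (fun s : M.obj (op V) => (s ⊗ₜ[Γ(X, V)] res N hV τ : (preTensor M N).obj (op V))) :=
  tmul_bijective_of_generator (R := Γ(X, V)) (P := M.obj (op V)) (Q := N.obj (op V)) _ (hτ V hV)

/-- Where `N` has a generator `τ`, the sections of the sheaf `M ⊗ N` are the `s ⊗ τ`. -/
theorem IsLocalGenerator.tmul_bijective (hM : HasGluing M) {U V : X.Opens} {τ : N.obj (op U)}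
    (hτ : IsLocalGenerator N U τ) (hV : V ≤ U) :
    Function.Bijective (fun s : M.obj (op V) => tmul s (res N hV τ)) := by
  have hinj (V : X.Opens) (hV : V ≤ U) :
      Function.Injective (fun s : M.obj (op V) => tmul s (res N hV τ)) := fun s s' h => by
    refine hM.sep V s s' fun y hy => ?_
    obtain ⟨W, hW, hyW, e⟩ := toTensor_locally_injective _ _ h y hy
    refine ⟨W, hW, hyW, (hτ.preTensor_bijective (hW.trans hV)).1 ?_⟩
    change res M hW s ⊗ₜ[Γ(X, W)] res N hW (res N hV τ) =
      res M hW s' ⊗ₜ[Γ(X, W)] res N hW (res N hV τ) at e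
    rwa [res_res] at e
  refine ⟨hinj V hV, fun u => ?_⟩
  -- Locally `u` comes from the presheaf tensor product, which `τ` identifies with `M`; injectivity
  -- lets the preimages glue in `M`.
  obtain ⟨s, hs⟩ := hM.glue V
    (fun W hW s => tmul s (res N (hW.trans hV) τ) = res (toPre (tensor M N)) hW u)
    (fun W W' hW h s hs => by rw [← res_res _ hW h, ← hs, res_tmul, res_res])
    (fun W hW s s' hs hs' => hinj W _ (hs.trans hs'.symm))
    (fun y hy => by
      obtain ⟨W, hW, hyW, p, hp⟩ := toTensor_locally_surjective u y hy
      obtain ⟨s, rfl⟩ := (hτ.preTensor_bijective (M := M) (hW.trans hV)).2 p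
      exact ⟨W, hW, hyW, s, hp⟩)
  refine ⟨s, (hasGluing_modules (tensor M N)).sep V _ _ fun y hy => ?_⟩
  obtain ⟨W, hW, hyW, e⟩ := hs y hy
  refine ⟨W, hW, hyW, ?_⟩
  rw [← e, res_tmul, res_res]

end tensor

/-! ### Uniformizers: restriction to the punctured curve and divisibility. -/

section uniformizer
variable {X : Scheme.{u}}

/-- A function on a neighbourhood of `x` that generates the maximal ideal at `x` and is invertible
elsewhere. -/
structure Uniformizer (x : X) where
  dom : X.Opens
  mem : x ∈ dom
  t : Γ(X, dom)
  irreducible : Irreducible (germFun x mem t)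
  isUnit (y : X) (hy : y ∈ dom) (h : y ≠ x) : IsUnit (germFun y hy t)

/-- The complement of a closed point. -/
def punctured {x : X} (hx : IsClosed {x}) : X.Opens := ⟨{x}ᶜ, hx.isOpen_compl⟩

variable {x : X} (hx : IsClosed {x})

lemma notMem_punctured {V : X.Opens} (hV : V ≤ punctured hx) : x ∉ V := fun h => hV h rfl

/-- On an integral scheme, restriction to a nonempty open set is injective. This is what allows
identities of functions to be checked away from `x`. -/
lemma resFun_punctured_injective [IsIntegral X] (D : Uniformizer x) (V : X.Opens) :
    Function.Injective (resFun (inf_le_left : V ⊓ punctured hx ≤ V)) := by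
  rcases (V : Set X).eq_empty_or_nonempty with h | h
  · intro a b _
    refine fun_sep V a b fun y hy => ?_
    have : y ∈ (V : Set X) := hy
    rw [h] at this
    exact this.elim
  · have hne : (punctured hx : Set X).Nonempty := by
      by_contra hempty
      rw [Set.not_nonempty_iff_eq_empty] at hempty
      have hgx : genericPoint X = x := by
        by_contra hg
        have : genericPoint X ∈ (punctured hx : Set X) := hg
        rw [hempty] at this
        exact this
      have hf : IsField (X.presheaf.stalk x) := by
        rw [← hgx]
        exact Field.toIsField X.functionField
      obtain ⟨a, ha⟩ := hf.mul_inv_cancel D.irreducible.ne_zero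
      exact D.irreducible.not_isUnit (IsUnit.of_mul_eq_one a ha)
    have : Nonempty (V ⊓ punctured hx : X.Opens) :=
      (nonempty_preirreducible_inter V.isOpen (punctured hx).isOpen h hne).to_subtype
    exact map_injective_of_isIntegral X (homOfLE inf_le_left)

variable (D : Uniformizer x)

/-- The restriction of the uniformizer. -/
abbrev Uniformizer.tRes {V : X.Opens} (hV : V ≤ D.dom) : Γ(X, V) := resFun hV D.t

lemma Uniformizer.isUnit_res {V : X.Opens} (hV : V ≤ D.dom) (hxV : x ∉ V) : IsUnit (D.tRes hV) := by
  refine RingedSpace.isUnit_of_isUnit_germ X.toRingedSpace V _ fun y hy => ?_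
  have h := D.isUnit y (hV hy) (fun h => hxV (h ▸ hy))
  rw [← germFun_resFun y hV hy] at h
  exact h

variable [IsIntegral X]

lemma Uniformizer.mul_left_cancel (hx : IsClosed {x}) (D : Uniformizer x) {V : X.Opens}
    (hV : V ≤ D.dom) (n : ℕ) {a b : Γ(X, V)}
    (h : D.tRes hV ^ n * a = D.tRes hV ^ n * b) : a = b := by
  refine resFun_punctured_injective hx D V ?_
  have hu := (D.isUnit_res (inf_le_left.trans hV : V ⊓ punctured hx ≤ D.dom)
    (notMem_punctured hx inf_le_right)).pow n
  refine hu.mul_left_cancel ?_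
  have := congrArg (resFun (inf_le_left : V ⊓ punctured hx ≤ V)) h
  simpa only [map_mul, map_pow, resFun_resFun] using this

/-- Divisibility by a power of the uniformizer can be tested on the germ at `x`. -/
lemma Uniformizer.dvd_of_germ (hx : IsClosed {x}) (D : Uniformizer x) {V : X.Opens} (hV : V ≤ D.dom)
    (n : ℕ) (f : Γ(X, V))
    (h : ∀ hxV : x ∈ V, germFun x D.mem D.t ^ n ∣ germFun x hxV f) : D.tRes hV ^ n ∣ f := by
  -- The quotient is unique, hence glues: near `x` it comes from the quotient of germs, elsewhere
  -- `t` is invertible.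
  obtain ⟨g, hg⟩ := fun_glue V (fun W hW g => D.tRes (hW.trans hV) ^ n * g = resFun hW f)
    (fun W W' hW h g hg => by
      rw [← resFun_resFun hW h, ← hg, map_mul, map_pow, resFun_resFun])
    (fun W hW s s' hs hs' => D.mul_left_cancel hx (hW.trans hV) n (hs.trans hs'.symm))
    (fun y hy => by
      by_cases hyx : y = x
      · subst hyx
        obtain ⟨c, hc⟩ := h hy
        obtain ⟨W, hyW, g, rfl⟩ := exists_germFun y c
        have hyI : y ∈ V ⊓ W := ⟨hy, hyW⟩
        rw [← germFun_resFun y hV hy, ← germFun_resFun y (inf_le_left : V ⊓ W ≤ V) hyI,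
          ← germFun_resFun y (inf_le_left : V ⊓ W ≤ V) hyI,
          ← germFun_resFun y (inf_le_right : V ⊓ W ≤ W) hyI, ← map_pow, ← map_mul] at hc
        obtain ⟨W', hW', hyW', e⟩ := germFun_eq hyI _ _ hc
        refine ⟨W', hW'.trans inf_le_left, hyW', resFun (hW'.trans inf_le_right) g, ?_⟩
        simpa only [map_mul, map_pow, resFun_resFun] using e.symm
      · refine ⟨V ⊓ punctured hx, inf_le_left, ⟨hy, hyx⟩, ?_⟩
        obtain ⟨v, hv⟩ := ((D.isUnit_res (inf_le_left.trans hV : V ⊓ punctured hx ≤ D.dom)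
          (notMem_punctured hx inf_le_right)).pow n).dvd
            (a := resFun (inf_le_left : V ⊓ punctured hx ≤ V) f)
        exact ⟨v, hv.symm⟩)
  refine ⟨g, fun_sep V _ _ fun y hy => ?_⟩
  obtain ⟨W, hW, hyW, e⟩ := hg y hy
  refine ⟨W, hW, hyW, ?_⟩
  rw [← e, map_mul, map_pow, resFun_resFun]

end uniformizer

/-! ### Sections and local generators of `𝒪(x)`. -/

section lineBundle
variable {X : Scheme.{u}} {x : X} (hx : IsClosed {x})

lemma mem_idealSections_of_notMem {V : X.Opens} (hxV : x ∉ V) (f : Γ(X, V)) :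
    f ∈ idealSections x V := fun h => (hxV h).elim

/-- The section `1` of `𝒪(x)`: the inclusion of `𝓘_x`. -/
def lineOne (x : X) (U : X.Opens) : (lineBundle x).obj (op U) :=
  (⟨fun V => (idealSections x V.1).subtype, fun _ _ _ _ => rfl⟩ :
    dualSections (idealSheaf x).toPresheafOfModules U)

/-- The value of a section of `𝒪(x) = ℋom(𝓘_x, 𝒪_X)` at a function that vanishes at `x`. -/
def lineEval {U V : X.Opens} (φ : (lineBundle x).obj (op U)) (hV : V ≤ U)
    (f : idealSections x V) : Γ(X, V) :=
  dualEval (M := (idealSheaf x).toPresheafOfModules) φ hV f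

/-- Restriction of functions that vanish at `x`. -/
def idealRes {U V : X.Opens} (hV : V ≤ U) (f : idealSections x U) : idealSections x V :=
  ⟨resFun hV f.1, (idealSheaf x).map (homOfLE hV).op f.2⟩

lemma lineEval_lineOne {U V : X.Opens} (hV : V ≤ U) (f : idealSections x V) :
    lineEval (lineOne x U) hV f = f.1 := rfl

lemma lineEval_res {U V W : X.Opens} (φ : (lineBundle x).obj (op U)) (hV : V ≤ U)
    (hW : W ≤ V) (s : idealSections x W) :
    lineEval (res (lineBundle x) hV φ) hW s = lineEval φ (hW.trans hV) s := rfl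

lemma lineEval_smul {U V : X.Opens} (a : Γ(X, U)) (φ : (lineBundle x).obj (op U))
    (hV : V ≤ U) (s : idealSections x V) :
    lineEval (a • φ) hV s = resFun hV a * lineEval φ hV s := rfl

lemma resFun_lineEval {U V W : X.Opens} (φ : (lineBundle x).obj (op U)) (hV : V ≤ U)
    (hW : W ≤ V) (s : idealSections x V) :
    resFun hW (lineEval φ hV s) = lineEval φ (hW.trans hV) (idealRes hW s) :=
  ((show dualSections (idealSheaf x).toPresheafOfModules U from φ).2 ⟨V, hV⟩
    ⟨W, hW.trans hV⟩ hW s).symm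

lemma lineEval_map_smul {U V : X.Opens} (φ : (lineBundle x).obj (op U))
    (hV : V ≤ U) (a : Γ(X, V)) (s : idealSections x V) :
    lineEval φ hV (a • s) = a * lineEval φ hV s :=
  map_smul ((show dualSections (idealSheaf x).toPresheafOfModules U from φ).1 ⟨V, hV⟩) a s

lemma line_ext {U : X.Opens} {φ ψ : (lineBundle x).obj (op U)}
    (h : ∀ (V : X.Opens) (hV : V ≤ U) (s : idealSections x V),
      lineEval φ hV s = lineEval ψ hV s) : φ = ψ :=
  Subtype.ext (funext fun V => LinearMap.ext fun s => h V.1 V.2 s)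

/-- If the ideal sheaf `𝓘_x` has a generator `f` on `U` and `φ(f) = 1`, then `φ` generates
`𝒪(x)` on `U`. -/
lemma isLocalGenerator_of_ideal {U : X.Opens} (f : idealSections x U)
    (hf : ∀ (V : X.Opens) (hV : V ≤ U) (g : idealSections x V),
      ∃ c : Γ(X, V), g = c • idealRes hV f)
    (φ : (lineBundle x).obj (op U)) (hφ : lineEval φ le_rfl f = 1) :
    IsLocalGenerator (lineBundle x) U φ := fun V hV => by
  have hφ' : lineEval φ hV (idealRes hV f) = 1 := by
    rw [← resFun_lineEval φ le_rfl hV f, hφ, map_one]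
  constructor
  · intro c d h
    have := congrArg (fun ψ => lineEval ψ (le_refl V) (idealRes hV f)) h
    beta_reduce at this
    rw [lineEval_smul, lineEval_smul, lineEval_res, hφ', resFun_self, resFun_self] at this
    simpa using this
  · intro ψ
    -- A section of the dual is determined by its value at `f`; since `φ(f) = 1`, this value is its
    -- coefficient.
    refine ⟨lineEval ψ (le_refl V) (idealRes hV f), line_ext fun W hW g => ?_⟩
    obtain ⟨c, rfl⟩ := hf W (hW.trans hV) g
    have h1 : idealRes hW (idealRes hV f) = idealRes (hW.trans hV) f :=
      Subtype.ext (resFun_resFun hV hW f.1)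
    beta_reduce
    rw [lineEval_smul, lineEval_res, lineEval_map_smul, lineEval_map_smul, resFun_lineEval,
      ← resFun_lineEval φ le_rfl (hW.trans hV) f, hφ, map_one, h1]
    ring

/-- Off `x` the ideal sheaf is the unit ideal, generated by `1`. -/
lemma isLocalGenerator_lineOne : IsLocalGenerator (lineBundle x) (punctured hx)
    (lineOne x (punctured hx)) :=
  isLocalGenerator_of_ideal ⟨1, mem_idealSections_of_notMem (notMem_punctured hx le_rfl) 1⟩
    (fun V hV g => ⟨g.1, Subtype.ext (by simp [idealRes])⟩) _ rfl

lemma Uniformizer.t_mem_ideal (D : Uniformizer x) : D.t ∈ idealSections x D.dom :=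
  fun _ => D.irreducible.not_isUnit

variable [IsIntegral X] [IsDiscreteValuationRing (X.presheaf.stalk x)] (D : Uniformizer x)

lemma Uniformizer.dvd_of_mem_ideal (hx : IsClosed {x}) (D : Uniformizer x) {V : X.Opens}
    (hV : V ≤ D.dom) (f : idealSections x V) :
    ∃ g : Γ(X, V), D.tRes hV * g = f.1 := by
  have := D.dvd_of_germ hx hV 1 f.1 fun hxV => by
    have h := f.2 hxV
    rw [D.irreducible.maximalIdeal_eq, Ideal.mem_span_singleton] at h
    rwa [pow_one]
  rw [pow_one] at this
  obtain ⟨g, hg⟩ := this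
  exact ⟨g, hg.symm⟩

/-- The quotient by the uniformizer of a function that vanishes at `x`. -/
def Uniformizer.quot {V : X.Opens} (hV : V ≤ D.dom) (f : idealSections x V) : Γ(X, V) :=
  (D.dvd_of_mem_ideal hx hV f).choose

lemma Uniformizer.mul_quot {V : X.Opens} (hV : V ≤ D.dom) (f : idealSections x V) :
    D.tRes hV * D.quot hx hV f = f.1 :=
  (D.dvd_of_mem_ideal hx hV f).choose_spec

lemma Uniformizer.quot_eq {V : X.Opens} (hV : V ≤ D.dom) {f : idealSections x V} {g : Γ(X, V)}
    (h : D.tRes hV * g = f.1) : D.quot hx hV f = g := by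
  refine D.mul_left_cancel hx hV 1 ?_
  rw [pow_one, h, D.mul_quot]

/-- Division by the uniformizer, as a linear map. -/
def Uniformizer.quotLin {V : X.Opens} (hV : V ≤ D.dom) : idealSections x V →ₗ[Γ(X, V)] Γ(X, V) where
  toFun := D.quot hx hV
  map_add' f g := D.quot_eq hx hV (by
    rw [mul_add, D.mul_quot, D.mul_quot]
    rfl)
  map_smul' a f := D.quot_eq hx hV (by
    rw [RingHom.id_apply, smul_eq_mul, mul_left_comm, D.mul_quot]
    rfl)

/-- The generator `f ↦ f / t` of `𝒪(x)` on the domain of the uniformizer `t`. -/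
def Uniformizer.lineGen : (lineBundle x).obj (op D.dom) :=
  (⟨fun V => D.quotLin hx V.2, fun V W h f => D.quot_eq hx W.2 (by
      change _ * resFun h (D.quot hx V.2 f) = resFun h f.1
      rw [← D.mul_quot hx V.2 f, map_mul, resFun_resFun])⟩ :
    dualSections (idealSheaf x).toPresheafOfModules D.dom)

lemma Uniformizer.mul_lineEval_lineGen {V : X.Opens} (hV : V ≤ D.dom) (f : idealSections x V) :
    D.tRes hV * lineEval (D.lineGen hx) hV f = f.1 :=
  D.mul_quot hx hV f

lemma Uniformizer.isLocalGenerator_lineGen :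
    IsLocalGenerator (lineBundle x) D.dom (D.lineGen hx) :=
  isLocalGenerator_of_ideal ⟨D.t, D.t_mem_ideal⟩
    (fun V hV g => ⟨D.quot hx hV g, Subtype.ext (by
      rw [← D.mul_quot hx hV g, mul_comm]
      rfl)⟩) _ (D.quot_eq hx le_rfl (by
        change resFun le_rfl D.t * 1 = D.t
        rw [mul_one, resFun_self]))

end lineBundle

/-! ### Sections of the Hecke transform and their description away from `x`. -/

section hecke
variable {X : Scheme.{u}} {E : X.Modules} {x : X}
  {L : Submodule (DualNumbersAt x) (doubleFiber (toPre E) x)}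

/-- Restriction of sections of the Hecke kernel. -/
def heckeRes {U V : X.Opens} (h : V ≤ U) (s : heckeSections (toPre E) x L U) :
    heckeSections (toPre E) x L V :=
  ⟨res (toPre E) h s.1, (heckeKernel (toPre E) x L).map (homOfLE h).op s.2⟩

/-- A section of `E` over an open set that does not contain `x` is a section of the Hecke kernel. -/
def toHeckeSections {V : X.Opens} (hxV : x ∉ V) (s : (toPre E).obj (op V)) :
    heckeSections (toPre E) x L V :=
  ⟨s, fun h => (hxV h).elim⟩

/-- The section `s ⊗ φ` of the Hecke transform. -/
def hTmul {U : X.Opens} (s : heckeSections (toPre E) x L U) (φ : (lineBundle x).obj (op U)) :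
    (toPre (heckeTransform E x L)).obj (op U) :=
  tmul (M := (heckeKernel (toPre E) x L).toPresheafOfModules) s φ

lemma hTmul_add_left {U : X.Opens} (s s' : heckeSections (toPre E) x L U)
    (φ : (lineBundle x).obj (op U)) : hTmul (s + s') φ = hTmul s φ + hTmul s' φ :=
  add_tmul (M := (heckeKernel (toPre E) x L).toPresheafOfModules) s s' φ

lemma hTmul_smul_left {U : X.Opens} (a : Γ(X, U)) (s : heckeSections (toPre E) x L U)
    (φ : (lineBundle x).obj (op U)) : hTmul (a • s) φ = a • hTmul s φ :=
  smul_tmul (M := (heckeKernel (toPre E) x L).toPresheafOfModules) a s φ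

lemma hTmul_smul_right {U : X.Opens} (a : Γ(X, U)) (s : heckeSections (toPre E) x L U)
    (φ : (lineBundle x).obj (op U)) : hTmul s (a • φ) = a • hTmul s φ :=
  tmul_smul (M := (heckeKernel (toPre E) x L).toPresheafOfModules) a s φ

lemma res_hTmul {U V : X.Opens} (h : V ≤ U) (s : heckeSections (toPre E) x L U)
    (φ : (lineBundle x).obj (op U)) : res (toPre (heckeTransform E x L)) h (hTmul s φ) =
      hTmul (heckeRes h s) (res (lineBundle x) h φ) :=
  res_tmul (M := (heckeKernel (toPre E) x L).toPresheafOfModules) h s φ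

lemma hTmul_bijective_of_generator {U V : X.Opens} {τ : (lineBundle x).obj (op U)}
    (hτ : IsLocalGenerator (lineBundle x) U τ) (hV : V ≤ U) :
    Function.Bijective (fun s : heckeSections (toPre E) x L V =>
      hTmul s (res (lineBundle x) hV τ)) :=
  hτ.tmul_bijective (hasGluing_heckeKernel (hasGluing_modules E) x L) hV

variable (hx : IsClosed {x})

/-- Off `x` the condition given by `L` is empty and `1` generates `𝒪(x)`, so the transform is `E`
itself. This identification underlies `away`. -/
lemma hTmul_lineOne_bijective {V : X.Opens} (hV : V ≤ punctured hx) :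
    Function.Bijective (fun s : (toPre E).obj (op V) =>
      hTmul (L := L) (toHeckeSections (notMem_punctured hx hV) s) (lineOne x V)) := by
  have h := hTmul_bijective_of_generator (L := L) (isLocalGenerator_lineOne hx) hV
  exact ⟨fun s s' e => congrArg Subtype.val (h.1 e), fun u => by
    obtain ⟨s, hs⟩ := h.2 u
    exact ⟨s.1, hs⟩⟩

/-- The section of `E` away from `x` given by a section of the Hecke transform. -/
def away {V : X.Opens} (u : (toPre (heckeTransform E x L)).obj (op V)) :
    (toPre E).obj (op (V ⊓ punctured hx)) :=
  ((hTmul_lineOne_bijective hx inf_le_right).2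
    (res (toPre (heckeTransform E x L)) inf_le_left u)).choose

lemma hTmul_away {V : X.Opens} (u : (toPre (heckeTransform E x L)).obj (op V)) :
    hTmul (toHeckeSections (notMem_punctured hx inf_le_right) (away hx u)) (lineOne x _) =
      res (toPre (heckeTransform E x L)) inf_le_left u :=
  ((hTmul_lineOne_bijective hx inf_le_right).2
    (res (toPre (heckeTransform E x L)) inf_le_left u)).choose_spec

lemma away_eq {V : X.Opens} {u : (toPre (heckeTransform E x L)).obj (op V)}
    {s : (toPre E).obj (op (V ⊓ punctured hx))}
    (h : hTmul (toHeckeSections (notMem_punctured hx inf_le_right) s) (lineOne x _) =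
      res (toPre (heckeTransform E x L)) inf_le_left u) : away hx u = s :=
  (hTmul_lineOne_bijective hx inf_le_right).1 ((hTmul_away hx u).trans h.symm)

lemma away_add {V : X.Opens} (u v : (toPre (heckeTransform E x L)).obj (op V)) :
    away hx (u + v) = away hx u + away hx v := by
  refine away_eq hx ?_
  rw [map_add, ← hTmul_away, ← hTmul_away, ← hTmul_add_left]
  rfl

lemma away_smul {V : X.Opens} (a : Γ(X, V)) (u : (toPre (heckeTransform E x L)).obj (op V)) :
    away hx (a • u) = resFun (inf_le_left : V ⊓ punctured hx ≤ V) a • away hx u := by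
  refine away_eq hx ?_
  rw [map_smulₛₗ, ← hTmul_away, ← hTmul_smul_left]
  rfl

lemma away_res {V W : X.Opens} (h : W ≤ V) (u : (toPre (heckeTransform E x L)).obj (op V)) :
    away hx (res (toPre (heckeTransform E x L)) h u) =
      res (toPre E) (inf_le_inf_right (punctured hx) h) (away hx u) := by
  refine away_eq hx ?_
  rw [res_res, ← res_res _ (inf_le_left : V ⊓ punctured hx ≤ V)
    (inf_le_inf_right (punctured hx) h), ← hTmul_away, res_hTmul]
  rfl

/-- The function `1` on an open set that does not contain `x`. -/
def idealOne {V : X.Opens} (hxV : x ∉ V) : idealSections x V :=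
  ⟨1, mem_idealSections_of_notMem hxV 1⟩

lemma line_eq_smul_lineOne {V : X.Opens} (hxV : x ∉ V) (φ : (lineBundle x).obj (op V)) :
    φ = (lineEval φ le_rfl (idealOne hxV) • lineOne x V : (lineBundle x).obj (op V)) := by
  refine line_ext fun W hW f => ?_
  have hf : f = f.1 • idealRes hW (idealOne hxV) :=
    Subtype.ext (by simp [idealRes, idealOne])
  conv_lhs => rw [hf]
  rw [lineEval_map_smul, lineEval_smul, lineEval_lineOne, resFun_lineEval, mul_comm]

/-- Off `x` the section `φ` is `φ(1)` times the generator, and the scalar moves across the tensor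
product. -/
lemma away_hTmul {V : X.Opens} (s : heckeSections (toPre E) x L V)
    (φ : (lineBundle x).obj (op V)) : away hx (hTmul s φ) =
      (lineEval φ inf_le_left (idealOne (notMem_punctured hx inf_le_right)) •
        res (toPre E) inf_le_left s.1 : (toPre E).obj (op (V ⊓ punctured hx))) := by
  refine away_eq hx ?_
  rw [res_hTmul, line_eq_smul_lineOne (notMem_punctured hx inf_le_right)
    (res (lineBundle x) inf_le_left φ), hTmul_smul_right, lineEval_res, ← hTmul_smul_left]
  rfl

/-! ### The induced form. -/

section form
variable (b : SymmForm (toPre E))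

/-- A function that is given by `b` away from `x`. -/
def IsFormValue {V : X.Opens} (u v : (toPre (heckeTransform E x L)).obj (op V)) (g : Γ(X, V)) :
    Prop :=
  resFun (inf_le_left : V ⊓ punctured hx ≤ V) g = b.form _ (away hx u) (away hx v)

variable {hx b}

lemma IsFormValue.restrict {V W : X.Opens} (h : W ≤ V)
    {u v : (toPre (heckeTransform E x L)).obj (op V)} {g : Γ(X, V)}
    (hg : IsFormValue hx b u v g) : IsFormValue hx b
      (res (toPre (heckeTransform E x L)) h u)
      (res (toPre (heckeTransform E x L)) h v) (resFun h g) := by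
  rw [IsFormValue, away_res, away_res, b.form_res, ← hg, resFun_resFun, resFun_resFun]

lemma IsFormValue.of_notMem {V : X.Opens} (hV : V ≤ punctured hx) (s t : (toPre E).obj (op V)) :
    IsFormValue hx b (hTmul (L := L) (toHeckeSections (notMem_punctured hx hV) s) (lineOne x V))
      (hTmul (L := L) (toHeckeSections (notMem_punctured hx hV) t) (lineOne x V))
      (b.form V s t) := by
  have key (s : (toPre E).obj (op V)) : away hx
      (hTmul (L := L) (toHeckeSections (notMem_punctured hx hV) s) (lineOne x V)) =
      res (toPre E) inf_le_left s := by
    rw [away_hTmul]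
    exact one_smul _ _
  rw [IsFormValue, key, key, b.form_res]

variable [IsIntegral X]

lemma IsFormValue.unique (D : Uniformizer x) {V : X.Opens}
    {u v : (toPre (heckeTransform E x L)).obj (op V)}
    {g g' : Γ(X, V)} (hg : IsFormValue hx b u v g) (hg' : IsFormValue hx b u v g') : g = g' :=
  resFun_punctured_injective hx D V (hg.trans hg'.symm)

variable [IsDiscreteValuationRing (X.presheaf.stalk x)] (D : Uniformizer x)

lemma Uniformizer.res_smul_away {V : X.Opens} (hV : V ≤ D.dom)
    (s : heckeSections (toPre E) x L V) :
    D.tRes (inf_le_left.trans hV : V ⊓ punctured hx ≤ D.dom) • away hx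
      (hTmul s (res (lineBundle x) hV (D.lineGen hx))) =
      res (toPre E) (inf_le_left : V ⊓ punctured hx ≤ V) s.1 := by
  rw [away_hTmul, lineEval_res, ← mul_smul, D.mul_lineEval_lineGen]
  exact one_smul _ _

/-- The generator of `𝒪(x)` is `1/t`, so each argument contributes one division by the uniformizer.
-/
lemma IsFormValue.iff_of_le_dom {V : X.Opens} (hV : V ≤ D.dom)
    {s t : heckeSections (toPre E) x L V} {g : Γ(X, V)} :
    IsFormValue hx b (hTmul s (res (lineBundle x) hV (D.lineGen hx)))
      (hTmul t (res (lineBundle x) hV (D.lineGen hx))) g ↔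
      b.form V s.1 t.1 = D.tRes hV ^ 2 * g := by
  have hu := (D.isUnit_res (inf_le_left.trans hV : V ⊓ punctured hx ≤ D.dom)
    (notMem_punctured hx inf_le_right)).pow 2
  rw [← (resFun_punctured_injective hx D V).eq_iff, ← b.form_res, ← D.res_smul_away (hx := hx) hV s,
    ← D.res_smul_away (hx := hx) hV t, IsFormValue, ← hu.mul_right_inj, map_mul, map_pow,
    resFun_resFun]
  simp only [map_smul, LinearMap.smul_apply, smul_eq_mul, ← mul_assoc, ← sq]
  exact eq_comm

/-- Where `b` takes values in `𝔪_x²` on the Hecke kernel, it induces a form on the Hecke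
transform. -/
lemma exists_isFormValue (hx : IsClosed {x}) (D : Uniformizer x) (b : SymmForm (toPre E))
    (hiso : ∀ f g : stalk (toPre E) x, 1 ⊗ₜ f ∈ L → 1 ⊗ₜ g ∈ L →
      b.stalkForm x f g ∈ IsLocalRing.maximalIdeal (X.presheaf.stalk x) ^ 2)
    {V : X.Opens} (u v : (toPre (heckeTransform E x L)).obj (op V)) :
    ∃ g, IsFormValue hx b u v g := by
  obtain ⟨g, hg⟩ := fun_glue V (fun W hW g => IsFormValue hx b
      (res (toPre (heckeTransform E x L)) hW u) (res (toPre (heckeTransform E x L)) hW v) g)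
    (fun W W' hW h g hg => by
      rw [← res_res _ hW h, ← res_res _ hW h]
      exact hg.restrict h)
    (fun W hW g g' hg hg' => hg.unique D hg')
    (fun y hy => by
      -- Near `x` both sections are multiples of the generator `1/t`, and `hiso` supplies
      -- divisibility by its square; elsewhere `b` itself is the value.
      by_cases hyx : y = x
      · subst hyx
        have hle : V ⊓ D.dom ≤ D.dom := inf_le_right
        obtain ⟨s, hs⟩ := (hTmul_bijective_of_generator (D.isLocalGenerator_lineGen hx) hle).2
          (res (toPre (heckeTransform E y L)) inf_le_left u)
        obtain ⟨t, ht⟩ := (hTmul_bijective_of_generator (D.isLocalGenerator_lineGen hx) hle).2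
          (res (toPre (heckeTransform E y L)) inf_le_left v)
        obtain ⟨g, hg⟩ := D.dvd_of_germ hx hle 2 (b.form _ s.1 t.1) fun hyV => by
          have := hiso _ _ (s.2 hyV) (t.2 hyV)
          rw [D.irreducible.maximalIdeal_eq, Ideal.span_singleton_pow,
            Ideal.mem_span_singleton] at this
          rw [← b.stalkVal_germ]
          exact this
        refine ⟨V ⊓ D.dom, inf_le_left, ⟨hy, D.mem⟩, g, ?_⟩
        rw [← hs, ← ht]
        exact (IsFormValue.iff_of_le_dom D hle).2 hg
      · refine ⟨V ⊓ punctured hx, inf_le_left, ⟨hy, hyx⟩, b.form _ (away hx u) (away hx v), ?_⟩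
        rw [← hTmul_away, ← hTmul_away]
        exact IsFormValue.of_notMem inf_le_right _ _)
  refine ⟨g, fun_sep _ _ _ fun y hy => ?_⟩
  obtain ⟨W, hW, hyW, e⟩ := hg y hy.1
  refine ⟨W ⊓ punctured hx, inf_le_inf_right _ hW, ⟨hyW, hy.2⟩, ?_⟩
  rw [IsFormValue, away_res, away_res, b.form_res, resFun_resFun] at e
  rw [resFun_resFun, e]

variable (hx b) in
/-- The form on the Hecke transform induced by `b`. -/
def heckeForm
    (hiso : ∀ f g : stalk (toPre E) x, 1 ⊗ₜ f ∈ L → 1 ⊗ₜ g ∈ L →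
      b.stalkForm x f g ∈ IsLocalRing.maximalIdeal (X.presheaf.stalk x) ^ 2) :
    SymmForm (toPre (heckeTransform E x L)) :=
  -- All axioms of the form follow one pattern: both sides are values for the same pair of sections,
  -- and such a value is unique.
  have hval {V : X.Opens} (u v : (toPre (heckeTransform E x L)).obj (op V)) :
      IsFormValue hx b u v (exists_isFormValue hx D b hiso u v).choose :=
    (exists_isFormValue hx D b hiso u v).choose_spec
  have hadd {V : X.Opens} (u u' v : (toPre (heckeTransform E x L)).obj (op V)) :
      (exists_isFormValue hx D b hiso (u + u') v).choose =
      (exists_isFormValue hx D b hiso u v).choose + (exists_isFormValue hx D b hiso u' v).choose :=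
    (hval _ _).unique D (by
      rw [IsFormValue, map_add, hval, hval, away_add, map_add, LinearMap.add_apply])
  have hsmul {V : X.Opens} (a : Γ(X, V)) (u v : (toPre (heckeTransform E x L)).obj (op V)) :
      (exists_isFormValue hx D b hiso (a • u) v).choose =
      a * (exists_isFormValue hx D b hiso u v).choose :=
    (hval _ _).unique D (by
      rw [IsFormValue, map_mul, hval, away_smul, map_smul, LinearMap.smul_apply, smul_eq_mul])
  have hsymm {V : X.Opens} (u v : (toPre (heckeTransform E x L)).obj (op V)) :
      (exists_isFormValue hx D b hiso u v).choose =
      (exists_isFormValue hx D b hiso v u).choose :=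
    (hval _ _).unique D (by rw [IsFormValue, hval, b.symm])
  { form := fun V => LinearMap.mk₂ Γ(X, V)
      (fun u v => (exists_isFormValue hx D b hiso u v).choose) hadd hsmul
      (fun u v v' => by rw [hsymm, hadd, hsymm v, hsymm v'])
      (fun a u v => by rw [hsymm, hsmul, hsymm v, smul_eq_mul])
    symm := fun V => hsymm
    form_res := fun h u v => (hval _ _).unique D ((hval u v).restrict h) }

variable (hx b) in
lemma isFormValue_heckeForm
    (hiso : ∀ f g : stalk (toPre E) x, 1 ⊗ₜ f ∈ L → 1 ⊗ₜ g ∈ L →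
      b.stalkForm x f g ∈ IsLocalRing.maximalIdeal (X.presheaf.stalk x) ^ 2)
    {V : X.Opens} (u v : (toPre (heckeTransform E x L)).obj (op V)) :
    IsFormValue hx b u v ((heckeForm hx b D hiso).form V u v) :=
  (exists_isFormValue hx D b hiso u v).choose_spec

lemma isInducedForm_heckeForm
    (hiso : ∀ f g : stalk (toPre E) x, 1 ⊗ₜ f ∈ L → 1 ⊗ₜ g ∈ L →
      b.stalkForm x f g ∈ IsLocalRing.maximalIdeal (X.presheaf.stalk x) ^ 2) :
    IsInducedForm b (heckeForm hx b D hiso) := by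
  intro U s t φ ψ V hV f g
  change f.1 * g.1 * resFun hV ((heckeForm hx b D hiso).form U (hTmul s φ) (hTmul t ψ)) =
    lineEval φ hV f * lineEval ψ hV g * resFun hV (b.form U s.1 t.1)
  refine resFun_punctured_injective hx D V ?_
  have h := (isFormValue_heckeForm hx b D hiso (hTmul s φ) (hTmul t ψ)).restrict hV
  -- Off `x`, linearity over functions gives `f φ(1) = φ(f)`, which turns the claim into bilinearity
  -- of `b`.
  have hval (φ : (lineBundle x).obj (op U)) (f : idealSections x V) :
      resFun (inf_le_left : V ⊓ punctured hx ≤ V) f.1 * lineEval φ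
          (inf_le_left.trans hV) (idealOne (notMem_punctured hx inf_le_right)) =
        resFun inf_le_left (lineEval φ hV f) := by
    rw [resFun_lineEval, ← lineEval_map_smul]
    congr 1
    exact Subtype.ext (mul_one _)
  rw [IsFormValue, res_hTmul, res_hTmul, away_hTmul, away_hTmul] at h
  simp only [map_smul, LinearMap.smul_apply, smul_eq_mul, lineEval_res, b.form_res] at h
  rw [map_mul, map_mul, h, map_mul, map_mul, ← hval, ← hval]
  have h' : b.form V (heckeRes hV s).1 (heckeRes hV t).1 = resFun hV (b.form U s.1 t.1) :=
    b.form_res hV s.1 t.1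
  rw [h']
  ring

end form

end hecke

/-! ### Local bases of the Hecke transform. -/

section heckeBasis
variable {X : Scheme.{u}} {E : X.Modules} {x : X}
  {L : Submodule (DualNumbersAt x) (doubleFiber (toPre E) x)} {ι : Type*} [Fintype ι]

/-- The map `s ↦ s ⊗ φ` to the Hecke transform. -/
def hTmulLin {U : X.Opens} (φ : (lineBundle x).obj (op U)) :
    heckeSections (toPre E) x L U →ₗ[Γ(X, U)] (toPre (heckeTransform E x L)).obj (op U) where
  toFun s := hTmul s φ
  map_add' s t := hTmul_add_left s t φ
  map_smul' a s := hTmul_smul_left a s φ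

/-- A basis of the Hecke kernel and a generator of `𝒪(x)` give a basis of the Hecke transform. -/
lemma isLocalBasis_hTmul {U : X.Opens} {τ : (lineBundle x).obj (op U)}
    (hτ : IsLocalGenerator (lineBundle x) U τ) (e : ι → heckeSections (toPre E) x L U)
    (he : ∀ (V : X.Opens) (hV : V ≤ U), Function.Bijective
      (fun c : ι → Γ(X, V) => ∑ i, c i • heckeRes hV (e i))) :
    IsLocalBasis (toPre (heckeTransform E x L)) U (fun i => hTmul (e i) τ) := fun V hV => by
  convert (hTmul_bijective_of_generator (L := L) hτ hV).comp (he V hV) using 1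
  funext c
  change _ = hTmulLin (res (lineBundle x) hV τ) (∑ i, c i • heckeRes hV (e i))
  rw [map_sum]
  refine Finset.sum_congr rfl fun i _ => ?_
  rw [map_smul, res_hTmul]
  rfl

lemma coe_sum_heckeRes {U V : X.Opens} (hV : V ≤ U) (e : ι → heckeSections (toPre E) x L U)
    (c : ι → Γ(X, V)) : (∑ i, c i • heckeRes hV (e i)).1 =
      ∑ i, c i • (res (toPre E) hV (e i).1 : (toPre E).obj (op V)) := by
  rw [Submodule.coe_sum]
  rfl

lemma bijective_toHeckeSections {U : X.Opens} (hxU : x ∉ U) {e : ι → (toPre E).obj (op U)}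
    (he : IsLocalBasis (toPre E) U e) (V : X.Opens) (hV : V ≤ U) : Function.Bijective
      (fun c : ι → Γ(X, V) => ∑ i, c i • heckeRes hV (toHeckeSections (L := L) hxU (e i))) := by
  constructor
  · intro c d h
    refine he.coord_ext hV ?_
    have := congrArg Subtype.val h
    beta_reduce at this
    rwa [coe_sum_heckeRes, coe_sum_heckeRes] at this
  · intro s
    obtain ⟨c, hc⟩ := he.exists_coord hV s.1
    exact ⟨c, Subtype.ext ((coe_sum_heckeRes hV _ c).trans hc.symm)⟩

lemma sum_smul_sum {R N : Type*} [CommRing R] [AddCommGroup N] [Module R N] (c : ι → R)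
    (A : Matrix ι ι R) (s : ι → N) :
    ∑ i, c i • ∑ j, A i j • s j = ∑ j, Matrix.vecMul c A j • s j := by
  simp only [Finset.smul_sum, Matrix.vecMul, dotProduct, Finset.sum_smul, mul_smul]
  exact Finset.sum_comm

variable [IsIntegral X] [DecidableEq ι]

/-- A basis of the stalk of the Hecke kernel extends to a basis on a neighbourhood. -/
theorem exists_heckeSections_basis (hx : IsClosed {x}) (D : Uniformizer x) {U : X.Opens}
    (hxU : x ∈ U) {e : ι → (toPre E).obj (op U)} (he : IsLocalBasis (toPre E) U e)
    (n : Module.Basis ι (X.presheaf.stalk x) (lattice L)) :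
    ∃ (W : X.Opens) (hxW : x ∈ W) (_ : W ≤ D.dom) (e' : ι → heckeSections (toPre E) x L W),
      (∀ i, germ (toPre E) x hxW (e' i).1 = n i) ∧ ∀ (V : X.Opens) (hV : V ≤ W),
        Function.Bijective (fun c : ι → Γ(X, V) => ∑ i, c i • heckeRes hV (e' i)) := by
  have ht2 : germFun x D.mem D.t ^ 2 ∈ IsLocalRing.maximalIdeal (X.presheaf.stalk x) ^ 2 :=
    Ideal.pow_mem_pow D.irreducible.not_isUnit 2
  have hnext {a c : ι → X.presheaf.stalk x}
      (h : ∑ k, a k • (n k : stalk (toPre E) x) = ∑ k, c k • (n k : stalk (toPre E) x)) :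
      a = c := by
    have h' : ∑ k, a k • n k = ∑ k, c k • n k := Subtype.ext (by
      simpa only [Submodule.coe_sum, Submodule.coe_smul] using h)
    have := congrArg n.equivFun h'
    simpa only [← n.equivFun_symm_apply, LinearEquiv.apply_symm_apply] using this
  obtain ⟨W₁, hxW₁, hW₁, f, hf⟩ := exists_germ_family (M := toPre E) x (fun i => (n i).1)
    (U ⊓ D.dom) ⟨hxU, D.mem⟩
  have hW₁U : W₁ ≤ U := hW₁.trans inf_le_left
  -- `A` expresses the lifted lattice basis `f` in terms of `e`. Below, `C` expresses `t² e` in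
  -- terms of `f`, which is possible since `t²F` lies in the lattice. On a small neighbourhood `A C
  -- = t²`.
  choose A hA using fun i => he.exists_coord hW₁U (f i)
  obtain ⟨W₂, hxW₂, hW₂, C, hC⟩ := exists_germFun_family x
    (fun jk : ι × ι => n.repr ⟨_, smul_mem_lattice L ht2 (germ (toPre E) x hxU (e jk.1))⟩ jk.2)
    W₁ hxW₁
  have hW₂D : W₂ ≤ D.dom := (hW₂.trans hW₁).trans inf_le_right
  have hgerm (j : ι) : germFun x D.mem D.t ^ 2 • germ (toPre E) x hxU (e j) =
      ∑ k, germFun x hxW₂ (C (j, k)) • (n k : stalk (toPre E) x) := by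
    have := congrArg Subtype.val
      (n.sum_repr ⟨_, smul_mem_lattice L ht2 (germ (toPre E) x hxU (e j))⟩)
    rw [Submodule.coe_sum] at this
    refine Eq.trans this.symm (Finset.sum_congr rfl fun k _ => ?_)
    rw [hC]
    rfl
  obtain ⟨W₃, hW₃, hxW₃, h₃⟩ := exists_nhd_res_eq (M := toPre E) hxW₂
    (fun j => D.tRes hW₂D ^ 2 • res (toPre E) (hW₂.trans hW₁U) (e j))
    (fun j => ∑ k, C (j, k) • res (toPre E) hW₂ (f k)) (fun j => by
      rw [germ_sum_smul, germ_smul, map_pow, germFun_resFun, germ_res, hgerm]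
      simp only [germ_res, hf])
  have hAC (i k : ι) : ∑ j, germFun x hxW₁ (A i j) * germFun x hxW₂ (C (j, k)) =
      germFun x D.mem D.t ^ 2 * (1 : Matrix ι ι (X.presheaf.stalk x)) i k := by
    refine congrFun (hnext (a := fun k => ∑ j, germFun x hxW₁ (A i j) * germFun x hxW₂ (C (j, k)))
      (c := fun k => germFun x D.mem D.t ^ 2 * (1 : Matrix ι ι (X.presheaf.stalk x)) i k) ?_) k
    have h1 : (n i : stalk (toPre E) x) =
        ∑ j, germFun x hxW₁ (A i j) • germ (toPre E) x hxU (e j) := by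
      rw [← hf i, hA i, germ_sum_smul]
      simp only [germ_res]
    have h2 : germFun x D.mem D.t ^ 2 • (n i : stalk (toPre E) x) =
        ∑ j, germFun x hxW₁ (A i j) • ∑ k, germFun x hxW₂ (C (j, k)) •
          (n k : stalk (toPre E) x) := by
      rw [h1, Finset.smul_sum]
      exact Finset.sum_congr rfl fun j _ => by rw [smul_comm, hgerm]
    have h3 : ∑ k, (germFun x D.mem D.t ^ 2 * (1 : Matrix ι ι (X.presheaf.stalk x)) i k) •
        (n k : stalk (toPre E) x) = germFun x D.mem D.t ^ 2 • (n i : stalk (toPre E) x) := by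
      simp [Matrix.one_apply, ite_smul]
    rw [h3, h2]
    simp only [Finset.smul_sum, Finset.sum_smul, mul_smul]
    exact Finset.sum_comm
  obtain ⟨W₄, hW₄, hxW₄, h₄⟩ := exists_nhd_resFun_eq hxW₃
    (fun ik : ι × ι => ∑ j, resFun (hW₃.trans hW₂) (A ik.1 j) * resFun hW₃ (C (j, ik.2)))
    (fun ik : ι × ι => D.tRes (hW₃.trans hW₂D) ^ 2 * (1 : Matrix ι ι Γ(X, W₃)) ik.1 ik.2)
    (fun ik => by
      simp only [map_sum, map_mul, map_pow, germFun_resFun, hAC]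
      simp only [Matrix.one_apply, apply_ite (germFun x hxW₃), map_one, map_zero])
  have hW₄₂ : W₄ ≤ W₂ := hW₄.trans hW₃
  have hW₄₁ : W₄ ≤ W₁ := hW₄₂.trans hW₂
  have hD : W₄ ≤ D.dom := hW₄₂.trans hW₂D
  refine ⟨W₄, hxW₄, hD, fun i => ⟨res (toPre E) hW₄₁ (f i), fun hx' => ?_⟩, fun i => ?_,
    fun V hV => ?_⟩
  · change germ (toPre E) x hx' _ ∈ lattice L
    rw [germ_res, hf]
    exact (n i).2
  · rw [germ_res, hf]
  let A' : Matrix ι ι Γ(X, V) := Matrix.of fun i j => resFun (hV.trans hW₄₁) (A i j)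
  let C' : Matrix ι ι Γ(X, V) := Matrix.of fun j k => resFun (hV.trans hW₄₂) (C (j, k))
  have hA' (i : ι) : res (toPre E) (hV.trans hW₄₁) (f i) =
      ∑ j, A' i j • res (toPre E) ((hV.trans hW₄₁).trans hW₁U) (e j) := by
    rw [hA i, res_sum_smul]
    simp only [res_res]
    rfl
  have hC' (j : ι) : D.tRes (hV.trans hD) ^ 2 •
      res (toPre E) ((hV.trans hW₄₁).trans hW₁U) (e j) =
      ∑ k, C' j k • res (toPre E) (hV.trans hW₄₁) (f k) := by
    have := congrArg (res (toPre E) (hV.trans hW₄)) (h₃ j)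
    rw [res_res, res_res, res_sum_smul, map_smulₛₗ, map_pow, resFun_resFun] at this
    simp only [res_res] at this
    exact this
  have hAC' : A' * C' = D.tRes (hV.trans hD) ^ 2 • (1 : Matrix ι ι Γ(X, V)) := by
    ext i k
    have := congrArg (resFun hV) (h₄ (i, k))
    rw [resFun_resFun, resFun_resFun] at this
    simp only [map_sum, map_mul, map_pow, resFun_resFun] at this
    rw [Matrix.mul_apply, Matrix.smul_apply, smul_eq_mul]
    refine this.trans ?_
    simp only [Matrix.one_apply, apply_ite (resFun (hV.trans hW₄)), map_one, map_zero]
  have hexp (c : ι → Γ(X, V)) : ∑ i, c i • (res (toPre E) (hV.trans hW₄₁) (f i) :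
      (toPre E).obj (op V)) = ∑ j, Matrix.vecMul c A' j •
        res (toPre E) ((hV.trans hW₄₁).trans hW₁U) (e j) := by
    simp only [hA']
    exact sum_smul_sum c A' _
  have hval (c : ι → Γ(X, V)) : (∑ i, c i • heckeRes hV (⟨res (toPre E) hW₄₁ (f i), fun hx' => by
      change germ (toPre E) x hx' _ ∈ lattice L
      rw [germ_res, hf]
      exact (n i).2⟩ : heckeSections (toPre E) x L W₄)).1 =
      ∑ i, c i • (res (toPre E) (hV.trans hW₄₁) (f i) : (toPre E).obj (op V)) := by
    rw [coe_sum_heckeRes]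
    simp only [res_res]
  constructor
  · intro c d h
    have h1 := congrArg Subtype.val h
    beta_reduce at h1
    rw [hval, hval, hexp, hexp] at h1
    have h2 := he.coord_ext _ h1
    -- Multiplication by `C'` turns `c A' = d A'` into `t² c = t² d`.
    have h3 := congrArg (fun v => Matrix.vecMul v C') h2
    beta_reduce at h3
    rw [Matrix.vecMul_vecMul, Matrix.vecMul_vecMul, hAC', Matrix.vecMul_smul, Matrix.vecMul_smul,
      Matrix.vecMul_one, Matrix.vecMul_one] at h3
    exact funext fun i => D.mul_left_cancel hx (hV.trans hD) 2 (congrFun h3 i)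
  · intro s
    obtain ⟨c, hc⟩ := he.exists_coord ((hV.trans hW₄₁).trans hW₁U) s.1
    have hts : D.tRes (hV.trans hD) ^ 2 • s.1 = ∑ k, Matrix.vecMul c C' k •
        (res (toPre E) (hV.trans hW₄₁) (f k) : (toPre E).obj (op V)) := by
      rw [← sum_smul_sum, hc, Finset.smul_sum]
      exact Finset.sum_congr rfl fun j _ => by rw [smul_comm, hC']
    -- The coefficients of `t² s` are divisible by `t²`: this need only be tested at `x`, where the
    -- germ of `s` lies in the lattice and has coordinates in the basis `n`.
    have hdvd (k : ι) : D.tRes (hV.trans hD) ^ 2 ∣ Matrix.vecMul c C' k := by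
      refine D.dvd_of_germ hx (hV.trans hD) 2 _ fun hxV => ?_
      have hs : germ (toPre E) x hxV s.1 = ∑ k, n.repr ⟨_, s.2 hxV⟩ k • (n k).1 := by
        have := congrArg Subtype.val (n.sum_repr ⟨germ (toPre E) x hxV s.1, s.2 hxV⟩)
        rw [Submodule.coe_sum] at this
        exact this.symm
      have h1 := congrArg (germ (toPre E) x hxV) hts
      rw [germ_sum_smul, germ_smul, map_pow, germFun_resFun, hs, Finset.smul_sum] at h1
      simp only [germ_res, hf, ← mul_smul] at h1
      exact ⟨_, (congrFun (hnext h1) k).symm⟩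
    choose d hd using hdvd
    refine ⟨d, Subtype.ext ?_⟩
    beta_reduce
    rw [hval, hexp, hc]
    -- Comparing the two expansions of `t² s` in the basis `e` and cancelling `t²` gives `c = d A'`.
    have h2 : ∑ j, (D.tRes (hV.trans hD) ^ 2 * c j) •
        res (toPre E) ((hV.trans hW₄₁).trans hW₁U) (e j) =
        ∑ j, (D.tRes (hV.trans hD) ^ 2 * Matrix.vecMul d A' j) •
          res (toPre E) ((hV.trans hW₄₁).trans hW₁U) (e j) := by
      simp only [mul_smul, ← Finset.smul_sum]
      rw [← hc, hts, ← hexp, Finset.smul_sum]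
      exact Finset.sum_congr rfl fun k _ => by rw [hd, mul_smul]
    have h3 := he.coord_ext _ h2
    refine Finset.sum_congr rfl fun j _ => ?_
    rw [D.mul_left_cancel hx (hV.trans hD) 2 (congrFun h3 j)]

end heckeBasis

/-! ### Invertible Gram matrices for the induced form. -/

section transform

lemma SymmForm.exists_isUnit_gram_res {X : Scheme.{u}} {M : PreMod X} {ι : Type*} [Fintype ι]
    [DecidableEq ι] (b : SymmForm M) {U : X.Opens} {e : ι → M.obj (op U)} {x : X} (hx : x ∈ U)
    (h : IsUnit (germFun x hx (b.gram U e).det)) :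
    ∃ (V : X.Opens) (hV : V ≤ U), x ∈ V ∧ IsUnit (b.gram V fun i => res M hV (e i)).det := by
  refine ⟨X.basicOpen (b.gram U e).det, X.basicOpen_le _, (X.mem_basicOpen _ x hx).2 h, ?_⟩
  have e' : b.gram _ (fun i => res M (X.basicOpen_le (b.gram U e).det) (e i)) =
      (b.gram U e).map (resFun (X.basicOpen_le (b.gram U e).det)) := by
    ext i j
    exact b.form_res _ _ _
  have hdet := RingHom.map_det (resFun (X.basicOpen_le (b.gram U e).det)) (b.gram U e)
  rw [RingHom.mapMatrix_apply] at hdet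
  rw [e', ← hdet]
  exact RingedSpace.isUnit_res_basicOpen X.toRingedSpace (b.gram U e).det

variable {X : Scheme.{u}} {E : X.Modules} {x : X}
  {L : Submodule (DualNumbersAt x) (doubleFiber (toPre E) x)} {ι : Type*} [Fintype ι]
  [DecidableEq ι] {b : SymmForm (toPre E)} [IsIntegral X]
  [IsDiscreteValuationRing (X.presheaf.stalk x)]

/-- Off `x`, tensoring a basis of `E` with the section `1` leaves its Gram matrix unchanged. -/
lemma exists_gram_heckeForm_of_ne (hx : IsClosed {x}) (D : Uniformizer x)
    (hiso : ∀ f g : stalk (toPre E) x, 1 ⊗ₜ f ∈ L → 1 ⊗ₜ g ∈ L →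
      b.stalkForm x f g ∈ IsLocalRing.maximalIdeal (X.presheaf.stalk x) ^ 2)
    (hb : b.IsNondegenerate) {y : X} (hyx : y ≠ x) {U : X.Opens} (hy : y ∈ U)
    {e : ι → (toPre E).obj (op U)} (he : IsLocalBasis (toPre E) U e) :
    ∃ (V : X.Opens) (_ : y ∈ V) (e' : ι → (toPre (heckeTransform E x L)).obj (op V)),
      IsLocalBasis (toPre (heckeTransform E x L)) V e' ∧
        IsUnit ((heckeForm hx b D hiso).gram V e').det := by
  have hV : U ⊓ punctured hx ≤ punctured hx := inf_le_right
  have he' := he.restrict (inf_le_left : U ⊓ punctured hx ≤ U)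
  have hτ : IsLocalGenerator (lineBundle x) (U ⊓ punctured hx) (lineOne x (U ⊓ punctured hx)) :=
    fun W hW => isLocalGenerator_lineOne hx W (hW.trans hV)
  refine ⟨U ⊓ punctured hx, ⟨hy, hyx⟩, _, isLocalBasis_hTmul hτ _
    (bijective_toHeckeSections (L := L) (notMem_punctured hx hV) he'), ?_⟩
  convert hb.isUnit_gram he' using 2
  ext i j
  exact (isFormValue_heckeForm hx b D hiso _ _).unique D (IsFormValue.of_notMem hV _ _)

/-- A lattice basis, spread out and tensored with `1/t`, is a basis of the transform. The germ at
`x` of its Gram matrix is that of `t⁻²b` on the lattice, invertible by `exists_gram_lattice`;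
invertibility of the determinant is an open condition. -/
lemma exists_gram_heckeForm_self {K : Type*} [Field K] (i : K →+* X.presheaf.stalk x)
    (hi : Function.Bijective ((IsLocalRing.residue (X.presheaf.stalk x)).comp i))
    (hK : (2 : K) ≠ 0) (hx : IsClosed {x}) (D : Uniformizer x)
    (hiso : ∀ f g : stalk (toPre E) x, 1 ⊗ₜ f ∈ L → 1 ⊗ₜ g ∈ L →
      b.stalkForm x f g ∈ IsLocalRing.maximalIdeal (X.presheaf.stalk x) ^ 2)
    (hb : b.IsNondegenerate) (hL : ∀ v ∈ L, b.doubleForm x v v = 0)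
    (hdim : @Module.finrank K L _ _ (Module.compHom L ((Ideal.Quotient.mk
      (IsLocalRing.maximalIdeal (X.presheaf.stalk x) ^ 2)).comp i)) = Fintype.card ι)
    {U : X.Opens} (hxU : x ∈ U) {e : ι → (toPre E).obj (op U)}
    (he : IsLocalBasis (toPre E) U e) :
    ∃ (V : X.Opens) (_ : x ∈ V) (e' : ι → (toPre (heckeTransform E x L)).obj (op V)),
      IsLocalBasis (toPre (heckeTransform E x L)) V e' ∧
        IsUnit ((heckeForm hx b D hiso).gram V e').det := by
  obtain ⟨B, -⟩ := he.exists_stalkBasis hxU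
  have : Module.Free (X.presheaf.stalk x) (stalk (toPre E) x) := .of_basis B
  have : Module.Finite (X.presheaf.stalk x) (stalk (toPre E) x) := .of_basis B
  have hrank : Module.finrank (X.presheaf.stalk x) (stalk (toPre E) x) = Fintype.card ι :=
    Module.finrank_eq_card_basis B
  have h2 : IsUnit (2 : X.presheaf.stalk x) := by
    simpa only [map_ofNat] using (isUnit_iff_ne_zero.2 hK).map i
  let n : Module.Basis ι (X.presheaf.stalk x) (lattice L) :=
    (Module.finBasisOfFinrankEq _ _ ((finrank_lattice L).trans hrank)).reindex
      (Fintype.equivFin ι).symm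
  obtain ⟨W, hxW, hW, f, hf, hfb⟩ := exists_heckeSections_basis hx D hxU he n
  have hτ : IsLocalGenerator (lineBundle x) W (res (lineBundle x) hW (D.lineGen hx)) :=
    fun V hV => by
      rw [res_res]
      exact D.isLocalGenerator_lineGen hx V (hV.trans hW)
  have hbasis := isLocalBasis_hTmul hτ f hfb
  have hG (j k : ι) : b.stalkForm x (n j).1 (n k).1 = germFun x D.mem D.t ^ 2 *
      ((heckeForm hx b D hiso).gram W
        fun i => hTmul (f i) (res (lineBundle x) hW (D.lineGen hx))).map (germFun x hxW) j k := by
    have h := (IsFormValue.iff_of_le_dom D hW).1 (isFormValue_heckeForm hx b D hiso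
      (hTmul (f j) (res (lineBundle x) hW (D.lineGen hx)))
      (hTmul (f k) (res (lineBundle x) hW (D.lineGen hx))))
    rw [← hf, ← hf]
    refine (b.stalkVal_germ x hxW _ _).trans ?_
    rw [h, map_mul, map_pow, germFun_resFun]
    rfl
  have hdet := exists_gram_lattice (b.stalkForm x) L i hi h2 (b.stalkVal_symm x)
    (b.stalkForm_surjective he (hb.isUnit_gram he) hxU) hL (hdim.trans hrank.symm) D.irreducible
    n _ hG
  rw [← RingHom.mapMatrix_apply, ← RingHom.map_det] at hdet
  obtain ⟨V, hV, hxV, hdetV⟩ := (heckeForm hx b D hiso).exists_isUnit_gram_res hxW hdet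
  exact ⟨V, hxV, _, hbasis.restrict hV, hdetV⟩

end transform

end

end OrthogonalHecke

/-! ### The theorem. -/

open OrthogonalHecke

theorem theorem1p1 {K : Type u} [Field K] [IsAlgClosed K] (hK : (2 : K) ≠ 0)
    (X : Scheme.{u}) [IsIntegral X] (p : X ⟶ Spec (CommRingCat.of K)) [IsProper p]
    [SmoothOfRelativeDimension 1 p] (x : X) (hx : IsClosed {x}) (r : ℕ) (E : X.Modules)
    (hE : OrthogonalHecke.IsVectorBundle E r)
    (b : OrthogonalHecke.SymmForm (OrthogonalHecke.toPre E)) (hb : b.IsNondegenerate)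
    (L : Submodule (OrthogonalHecke.DualNumbersAt x)
      (OrthogonalHecke.doubleFiber (OrthogonalHecke.toPre E) x))
    (hL : OrthogonalHecke.IsLagrangian p b r L) :
    OrthogonalHecke.IsVectorBundle (OrthogonalHecke.heckeTransform E x L) r ∧
      ∃ b' : OrthogonalHecke.SymmForm
          (OrthogonalHecke.toPre (OrthogonalHecke.heckeTransform E x L)),
        b'.IsNondegenerate ∧ OrthogonalHecke.IsInducedForm b b' := by
  have : IsLocallyNoetherian X := LocallyOfFiniteType.isLocallyNoetherian p
  have : IsDiscreteValuationRing (X.presheaf.stalk x) := isDiscreteValuationRing_stalk p x hx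
  obtain ⟨U, hxU, t, ht, hunit⟩ := exists_uniformizer x hx
  let D : Uniformizer x := ⟨U, hxU, t, ht, hunit⟩
  have h2 : IsUnit (2 : X.presheaf.stalk x) := by
    simpa only [map_ofNat] using (isUnit_iff_ne_zero.2 hK).map (baseToStalk p x)
  have hiso := form_mem_of_isotropic (b.stalkForm x) L h2 (b.stalkVal_symm x) hL.isotropic
  -- The same local bases prove both local freeness of rank `r` and non-degeneracy.
  have hloc (y : X) : ∃ (V : X.Opens) (_ : y ∈ V)
      (e' : Fin r → (toPre (heckeTransform E x L)).obj (op V)),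
      IsLocalBasis (toPre (heckeTransform E x L)) V e' ∧
        IsUnit ((heckeForm hx b D hiso).gram V e').det := by
    obtain ⟨V, hy, e, he⟩ := hE y
    by_cases hyx : y = x
    · subst hyx
      exact exists_gram_heckeForm_self (baseToStalk p y) (residue_baseToStalk_bijective p y hx) hK
        hx D hiso hb hL.isotropic (hL.dim_eq.trans (Fintype.card_fin r).symm) hy he
    · exact exists_gram_heckeForm_of_ne hx D hiso hb hyx hy he
  refine ⟨fun y => ?_, heckeForm hx b D hiso,
    (heckeForm hx b D hiso).isNondegenerate_of_gram (hasGluing_modules _) hloc,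
    isInducedForm_heckeForm D hiso⟩
  obtain ⟨V, hy, e, he, -⟩ := hloc y
  exact ⟨V, hy, e, he⟩
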